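/- Let $(R,\mathfrak m)$ be a Cohen–Macaulay local ring (in particular Noetherian) of dimension $d>0$ with infinite residue field, let $I$ be an $\mathfrak m$-primary ideal of $R$, and let $J\subseteq I$ be a minimal reduction of $I$, that is, $J$ is minimal with respect to inclusion among the ideals $K\subseteq I$ such that $I^{n+1}=KI^n$ for some $n\ge 0$. Let $F(I)=\bigoplus_{n\ge 0} I^n/\mathfrak m I^n$ be the fiber cone of $I$, let $\operatorname{depth} F(I)$ be its depth with respect to its maximal homogeneous ideal $\bigoplus_{n\ge 1} I^n/\mathfrak m I^n$, and let $\lambda(-)$ denote the length of an $R$-module. Suppose that $I^3=I^2J$. Then: (i) if $\lambda(I^2/IJ)=1=\lambda(\mathfrak m I^2/\mathfrak m JI)$, then $\operatorname{depth} F(I)\ge d-1$; (ii) if $\lambda(I^2/IJ)=2$ and $\lambda(\mathfrak m I^2/\mathfrak m IJ)=1$, then $\operatorname{depth} F(I)\ge d-2$; (iii) if $\lambda(I^2/IJ)=2=\lambda(\mathfrak m I/\mathfrak m J)$ and $\mathfrak m I^2=\mathfrak m IJ$, then $\operatorname{depth} F(I)\ge d-2$. -/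

import Mathlib

open IsLocalRing

universe u v

/-- The depth of an `A`-module `M` with respect to an ideal `𝔞` of `A`: the supremum of the lengths
of the `M`-regular sequences contained in `𝔞`. -/
noncomputable def idealDepth {A : Type u} [CommRing A] (𝔞 : Ideal A) (M : Type v)
    [AddCommGroup M] [Module A M] : ℕ∞ :=
  ⨆ rs : {rs : List A // (∀ r ∈ rs, r ∈ 𝔞) ∧ RingTheory.Sequence.IsRegular M rs},
    (rs.1.length : ℕ∞)

/-- A Cohen-Macaulay local ring: a Noetherian local ring whose depth (with respect to its maximal
ideal) equals its Krull dimension. -/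
structure IsCohenMacaulayLocalRing (R : Type u) [CommRing R] [IsLocalRing R] : Prop where
  isNoetherianRing : IsNoetherianRing R
  depth_eq_dim : (idealDepth (maximalIdeal R) R : WithBot ℕ∞) = ringKrullDim R

/-- The ideal `I` of the local ring `(R, 𝔪)` is `𝔪`-primary. -/
def IsMaximalIdealPrimary {R : Type u} [CommRing R] [IsLocalRing R] (I : Ideal R) : Prop :=
  I.IsPrimary ∧ I.radical = maximalIdeal R

/-- `J` is a reduction of `I`: `J ⊆ I` and `I ^ (n + 1) = J I ^ n` for some `n ≥ 0`. -/
def IsReduction {R : Type u} [CommRing R] (J I : Ideal R) : Prop :=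
  J ≤ I ∧ ∃ n : ℕ, I ^ (n + 1) = J * I ^ n

/-- `J` is a minimal reduction of `I`: it is minimal, with respect to inclusion, among the
reductions of `I`. -/
def IsMinimalReduction {R : Type u} [CommRing R] (J I : Ideal R) : Prop :=
  Minimal (fun K : Ideal R => IsReduction K I) J

/-- The length `λ(A / B)` of the `R`-module `A / B`, for ideals `B ⊆ A` of `R`. -/
noncomputable def quotientLength {R : Type u} [CommRing R] (A B : Ideal R) : ℕ∞ :=
  Module.length R (A ⧸ Submodule.submoduleOf B A)

/-- The ideal `⨁ 𝔪 I ^ n t ^ n` of the Rees algebra `⨁ I ^ n t ^ n ⊆ R[t]`. -/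
def fiberConeIdeal {R : Type u} [CommRing R] [IsLocalRing R] (I : Ideal R) :
    Ideal (reesAlgebra I) where
  carrier := {f | ∀ n : ℕ, (f : Polynomial R).coeff n ∈ maximalIdeal R * I ^ n}
  zero_mem' n := by simp
  add_mem' hf hg n := by
    simpa using Ideal.add_mem _ (hf n) (hg n)
  smul_mem' f g hg n := by
    simp only [smul_eq_mul, MulMemClass.coe_mul, Polynomial.coeff_mul]
    refine Ideal.sum_mem _ fun p hp => ?_
    rw [← Finset.HasAntidiagonal.mem_antidiagonal.mp hp, pow_add, mul_left_comm]
    exact Ideal.mul_mem_mul (f.2 p.1) (hg p.2)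

/-- The fiber cone `F(I) = ⨁ I ^ n / 𝔪 I ^ n`, with the multiplication induced by that of `R`,
as the quotient of the Rees algebra `⨁ I ^ n t ^ n` by `⨁ 𝔪 I ^ n t ^ n`. -/
abbrev FiberCone {R : Type u} [CommRing R] [IsLocalRing R] (I : Ideal R) : Type u :=
  reesAlgebra I ⧸ fiberConeIdeal I

/-- The maximal homogeneous ideal `𝔪 ⊕ (⨁ I ^ n t ^ n, n ≥ 1)` of the Rees algebra. -/
def reesMaximalIdeal {R : Type u} [CommRing R] [IsLocalRing R] (I : Ideal R) :
    Ideal (reesAlgebra I) where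
  carrier := {f | (f : Polynomial R).coeff 0 ∈ maximalIdeal R}
  zero_mem' := by simp
  add_mem' {f g} hf hg := by
    simpa using (maximalIdeal R).add_mem hf hg
  smul_mem' f g hg := by
    simpa [Polynomial.mul_coeff_zero] using
      (maximalIdeal R).mul_mem_left ((f : Polynomial R).coeff 0) hg

/-- The maximal homogeneous ideal `⨁ I ^ n / 𝔪 I ^ n`, `n ≥ 1`, of the fiber cone: the image of the
maximal homogeneous ideal of the Rees algebra. -/
noncomputable def fiberConeMaximalIdeal {R : Type u} [CommRing R] [IsLocalRing R] (I : Ideal R) :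
    Ideal (FiberCone I) :=
  (reesMaximalIdeal I).map (Ideal.Quotient.mk (fiberConeIdeal I))

/-- The depth of the fiber cone `F(I)`, with respect to its maximal homogeneous ideal. -/
noncomputable def fiberConeDepth {R : Type u} [CommRing R] [IsLocalRing R] (I : Ideal R) : ℕ∞ :=
  idealDepth (A := FiberCone I) (fiberConeMaximalIdeal I) (FiberCone I)

/-! All three cases follow from one bound, depth F(I) ≥ d - 1, valid whenever I³ = I²J, λ(I²/IJ) ≤ 2
and λ(𝔪I²/𝔪IJ) ≤ 1.

A minimal reduction J is generated by d elements x_i that are independent modulo 𝔪I and, R being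
Cohen–Macaulay, quasi-regular (`IsMinimalReduction.exists_quasiRegular`). Let S = k[X_1, …, X_d] act
on F = F(I) through the classes of x_i t, and choose z_1, …, z_r in I that form a basis of I/(J +
𝔪I). The S-linear map Ψ : S × S^r → F sends the basis to 1 and the classes of z_j t. Its image
consists of the elements whose degree n part comes from IJ^(n-1) + 𝔪I^n for n ≥ 1, with no condition
in degree 0.

The kernel of Ψ is cyclic (`QuasiRegular.exists_ker_presentationMap`). Relations modulo 𝔪IJ^n are
trivial by quasi-regularity, and 𝔪I² is generated by a single element u modulo 𝔪IJ. So either u lies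
in IJ and every relation is a multiple of the one it gives, or there are no relations at all.

The cokernel of Ψ is torsion-free (`eq_zero_or_exists_eq_presentationMap` with
`QuasiRegular.mem_stepIdeal_of_maximalIdeal_mul_sq_le` and `QuasiRegular.mem_stepIdeal_of_notMem`).
It has two generators because λ(I²/IJ) ≤ 2 and I^(n+2) = I²J^n. As S is factorial, the relations of
a torsion-free module with two generators form a cyclic module
(`HasDepthGE.of_torsionFree_of_span_pair`).

Thus image and cokernel are both quotients of finite free modules by cyclic submodules, of depth at
least d - 1 each, and F lies between them in a short exact sequence. -/

/-- There is a weakly `M`-regular sequence of length `n` in the ideal `𝔫`. -/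
def HasDepthGE {S : Type*} [CommRing S] (𝔫 : Ideal S) (M : Type*) [AddCommGroup M] [Module S M]
    (n : ℕ) : Prop :=
  ∃ rs : List S, rs.length = n ∧ (∀ r ∈ rs, r ∈ 𝔫) ∧ RingTheory.Sequence.IsWeaklyRegular M rs

/-! ### Depth of finite modules over a Noetherian ring -/

section DepthTheory

open RingTheory.Sequence

variable {S : Type*} [CommRing S] {𝔫 : Ideal S}

theorem hasDepthGE_zero (M : Type*) [AddCommGroup M] [Module S M] : HasDepthGE 𝔫 M 0 :=
  ⟨[], rfl, by simp, IsWeaklyRegular.nil S M⟩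

theorem hasDepthGE_succ_iff {M : Type*} [AddCommGroup M] [Module S M] {n : ℕ} :
    HasDepthGE 𝔫 M (n + 1) ↔
      ∃ z ∈ 𝔫, IsSMulRegular M z ∧ HasDepthGE 𝔫 (QuotSMulTop z M) n := by
  constructor
  · rintro ⟨rs, hl, hm, hr⟩
    obtain ⟨z, rs, rfl⟩ := List.exists_cons_of_length_eq_add_one hl
    rw [isWeaklyRegular_cons_iff] at hr
    exact ⟨z, hm z (by simp), hr.1, rs, by simpa using hl,
      fun r h => hm r (List.mem_cons_of_mem _ h), hr.2⟩
  · rintro ⟨z, hz, hreg, rs, hl, hm, hr⟩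
    refine ⟨z :: rs, by simp [hl], ?_, IsWeaklyRegular.cons hreg hr⟩
    intro r h
    rcases List.mem_cons.1 h with rfl | h
    exacts [hz, hm r h]

theorem HasDepthGE.pred {M : Type*} [AddCommGroup M] [Module S M] {n : ℕ}
    (h : HasDepthGE 𝔫 M (n + 1)) : HasDepthGE 𝔫 M n := by
  obtain ⟨rs, hl, hm, hr⟩ := h
  refine ⟨rs.take n, by simp [hl], fun r h => hm r (List.mem_of_mem_take h), ?_⟩
  rw [← List.take_append_drop n rs, isWeaklyRegular_append_iff] at hr
  exact hr.1

theorem HasDepthGE.congr {M N : Type*} [AddCommGroup M] [Module S M] [AddCommGroup N] [Module S N]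
    (e : M ≃ₗ[S] N) {n : ℕ} (h : HasDepthGE 𝔫 M n) : HasDepthGE 𝔫 N n := by
  obtain ⟨rs, hl, hm, hr⟩ := h
  exact ⟨rs, hl, hm, (e.isWeaklyRegular_congr rs).1 hr⟩

theorem HasDepthGE.of_finite_free {n : ℕ} (h : HasDepthGE 𝔫 S n) (M : Type*) [AddCommGroup M]
    [Module S M] [Module.Free S M] : HasDepthGE 𝔫 M n := by
  obtain ⟨rs, hl, hm, hr⟩ := h
  refine ⟨rs, hl, hm, ?_⟩
  have := IsWeaklyRegular.isWeaklyRegular_rTensor (M₂ := M) hr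
  exact ((TensorProduct.lid S M).isWeaklyRegular_congr rs).1 this

/-- No nonzero element of `M` is killed by `𝔫`. -/
def SocleFree (𝔫 : Ideal S) (M : Type*) [AddCommGroup M] [Module S M] : Prop :=
  ∀ m : M, (∀ a ∈ 𝔫, a • m = 0) → m = 0

theorem SocleFree.of_isSMulRegular {M : Type*} [AddCommGroup M] [Module S M] {z : S} (hz : z ∈ 𝔫)
    (h : IsSMulRegular M z) : SocleFree 𝔫 M :=
  fun _ hm => h.right_eq_zero_of_smul (hm z hz)

theorem SocleFree.of_hasDepthGE {M : Type*} [AddCommGroup M] [Module S M] {n : ℕ}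
    (h : HasDepthGE 𝔫 M (n + 1)) : SocleFree 𝔫 M := by
  obtain ⟨z, hz, hreg, -⟩ := hasDepthGE_succ_iff.1 h
  exact .of_isSMulRegular hz hreg

theorem SocleFree.prod {M N : Type*} [AddCommGroup M] [Module S M] [AddCommGroup N] [Module S N]
    (h : SocleFree 𝔫 M) (h' : SocleFree 𝔫 N) : SocleFree 𝔫 (M × N) := fun _ hm =>
  Prod.ext (h _ fun a ha => congrArg Prod.fst (hm a ha)) (h' _ fun a ha => congrArg Prod.snd (hm a ha))

/-- Prime avoidance: if `𝔫` consists of zero divisors, it lies in one of the finitely many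
associated primes, whose defining element is then killed by `𝔫`. Applied to products, this yields
one element regular on several modules at once. -/
theorem SocleFree.exists_isSMulRegular [IsNoetherianRing S] {M : Type*} [AddCommGroup M]
    [Module S M] [Module.Finite S M] (h : SocleFree 𝔫 M) : ∃ z ∈ 𝔫, IsSMulRegular M z := by
  by_contra! hne
  have hfin := associatedPrimes.finite S M
  have hsub : (𝔫 : Set S) ⊆ ⋃ p ∈ (hfin.toFinset : Set (Ideal S)), (p : Set S) := by
    intro z hz
    have : z ∈ {r : S | IsSMulRegular M r}ᶜ := hne z hz
    rw [← biUnion_associatedPrimes_eq_compl_regular S] at this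
    simpa using this
  rw [Ideal.subset_union_prime (f := fun p : Ideal S => p) ⊤ ⊤] at hsub
  · obtain ⟨p, hp, hle⟩ := hsub
    have hp : IsAssociatedPrime p M := hfin.mem_toFinset.1 hp
    obtain ⟨hpp, m, hm⟩ := isAssociatedPrime_iff_exists_injective_linearMap p M |>.1 hp
    have h0 : m (Ideal.Quotient.mk p 1) = 0 := by
      refine h _ fun a ha => ?_
      rw [← map_smul, ← map_zero m]
      congr 1
      rw [Algebra.smul_def, Ideal.Quotient.algebraMap_eq, ← map_mul, mul_one]
      exact Ideal.Quotient.eq_zero_iff_mem.2 (hle ha)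
    rw [← map_zero m] at h0
    have := hm h0
    rw [map_one] at this
    exact hpp.ne_top ((Ideal.Quotient.subsingleton_iff).1 (subsingleton_of_zero_eq_one this.symm))
  · intro p hp _ _
    exact (show IsAssociatedPrime p M from hfin.mem_toFinset.1 hp).isPrime

theorem IsSMulRegular.of_prod_left {M N : Type*} [AddCommGroup M] [Module S M] [AddCommGroup N]
    [Module S N] {z : S} (h : IsSMulRegular (M × N) z) : IsSMulRegular M z := fun a b hab =>
  congrArg Prod.fst (@h (a, 0) (b, 0) (Prod.ext hab (by simp)))

theorem IsSMulRegular.of_prod_right {M N : Type*} [AddCommGroup M] [Module S M] [AddCommGroup N]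
    [Module S N] {z : S} (h : IsSMulRegular (M × N) z) : IsSMulRegular N z := fun a b hab =>
  congrArg Prod.snd (@h (0, a) (0, b) (Prod.ext (by simp) hab))

theorem QuotSMulTop.mk_eq_zero_iff {M : Type*} [AddCommGroup M] [Module S M] {x : S} {m : M} :
    (Submodule.Quotient.mk m : QuotSMulTop x M) = 0 ↔ ∃ m', m = x • m' := by
  rw [Submodule.Quotient.mk_eq_zero, Submodule.mem_smul_pointwise_iff_exists]
  simp [eq_comm]

theorem isSMulRegular_quotSMulTop_iff {M : Type*} [AddCommGroup M] [Module S M] {x y : S} :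
    IsSMulRegular (QuotSMulTop x M) y ↔ ∀ m m' : M, y • m = x • m' → ∃ m'', m = x • m'' := by
  rw [isSMulRegular_iff_right_eq_zero_of_smul]
  constructor
  · intro h m m' hm
    exact QuotSMulTop.mk_eq_zero_iff.1 (h (Submodule.Quotient.mk m) (by
      rw [← Submodule.Quotient.mk_smul]
      exact QuotSMulTop.mk_eq_zero_iff.2 ⟨m', hm⟩))
  · intro h m hm
    obtain ⟨m, rfl⟩ := Submodule.Quotient.mk_surjective _ m
    rw [← Submodule.Quotient.mk_smul] at hm
    obtain ⟨m', hm'⟩ := QuotSMulTop.mk_eq_zero_iff.1 hm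
    exact QuotSMulTop.mk_eq_zero_iff.2 (h m m' hm')

/-- If m is a socle element modulo x and y m = x m', then m' is a socle element modulo y. This
replaces the comparison of both socles with Ext¹(S/𝔫, M). -/
theorem SocleFree.quotSMulTop {M : Type*} [AddCommGroup M] [Module S M] {x y : S} (hyn : y ∈ 𝔫)
    (hx : IsSMulRegular M x) (hy : IsSMulRegular M y) (h : SocleFree 𝔫 (QuotSMulTop y M)) :
    SocleFree 𝔫 (QuotSMulTop x M) := by
  intro m hm
  obtain ⟨m, rfl⟩ := Submodule.Quotient.mk_surjective _ m
  simp_rw [← Submodule.Quotient.mk_smul, QuotSMulTop.mk_eq_zero_iff] at hm ⊢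
  obtain ⟨m', hm'⟩ := hm y hyn
  have : (Submodule.Quotient.mk m' : QuotSMulTop y M) = 0 := by
    refine h _ fun a ha => ?_
    rw [← Submodule.Quotient.mk_smul, QuotSMulTop.mk_eq_zero_iff]
    obtain ⟨b, hb⟩ := hm a ha
    refine ⟨b, hx ?_⟩
    change x • a • m' = x • y • b
    rw [smul_comm, ← hm', smul_comm, hb, smul_comm]
  obtain ⟨b, rfl⟩ := QuotSMulTop.mk_eq_zero_iff.1 this
  refine ⟨b, hy ?_⟩
  change y • m = y • x • b
  rw [hm', smul_comm]

theorem IsSMulRegular.quotSMulTop_swap {M : Type*} [AddCommGroup M] [Module S M] {x y : S}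
    (hx : IsSMulRegular M x) (h : IsSMulRegular (QuotSMulTop x M) y) :
    IsSMulRegular (QuotSMulTop y M) x := by
  rw [isSMulRegular_quotSMulTop_iff] at h ⊢
  intro m m' hm
  obtain ⟨a, rfl⟩ := h m' m hm.symm
  exact ⟨a, hx (by change x • m = x • y • a; rw [hm, smul_comm])⟩

/-- The two iterated quotients by `x` and `y` agree. -/
noncomputable def QuotSMulTop.commEquiv (M : Type*) [AddCommGroup M] [Module S M] (x y : S) :
    QuotSMulTop y (QuotSMulTop x M) ≃ₗ[S] QuotSMulTop x (QuotSMulTop y M) :=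
  (QuotSMulTop.equivQuotTensor y _).trans <|
    (LinearEquiv.lTensor _ (QuotSMulTop.equivQuotTensor x M)).trans <|
    (TensorProduct.leftComm S _ _ M).trans <|
    (LinearEquiv.lTensor _ (QuotSMulTop.equivQuotTensor y M)).symm.trans
    (QuotSMulTop.equivQuotTensor x _).symm

/-- Depth does not depend on the first element chosen. An element z regular on M, M/xM and M/yM
mediates: the bound passes from M/yM to M/(y, z)M, hence to M/zM, then to M/(z, x)M and finally to
M/xM. -/
theorem HasDepthGE.quotSMulTop [IsNoetherianRing S] {n : ℕ} : ∀ {M : Type v} [AddCommGroup M]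
    [Module S M] [Module.Finite S M] {x : S}, x ∈ 𝔫 → IsSMulRegular M x →
    HasDepthGE 𝔫 M (n + 1) → HasDepthGE 𝔫 (QuotSMulTop x M) n := by
  induction n with
  | zero => intro M _ _ _ x _ _ _; exact hasDepthGE_zero _
  | succ n ih =>
    intro M _ _ _ x hx hxreg h
    obtain ⟨y, hy, hyreg, hd⟩ := hasDepthGE_succ_iff.1 h
    have hsy := SocleFree.of_hasDepthGE hd
    obtain ⟨z, hz, hzreg⟩ := ((SocleFree.of_isSMulRegular hx hxreg).prod
      ((hsy.quotSMulTop hy hxreg hyreg).prod hsy)).exists_isSMulRegular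
    have hz1 := hzreg.of_prod_left
    have hz2 := hzreg.of_prod_right.of_prod_left
    have hz3 := hzreg.of_prod_right.of_prod_right
    have h1 : HasDepthGE 𝔫 (QuotSMulTop y (QuotSMulTop z M)) n :=
      (ih hz hz3 hd).congr (QuotSMulTop.commEquiv M y z)
    have h2 : HasDepthGE 𝔫 (QuotSMulTop z M) (n + 1) :=
      hasDepthGE_succ_iff.2 ⟨y, hy, hyreg.quotSMulTop_swap hz3, h1⟩
    have h3 := ih hx (hxreg.quotSMulTop_swap hz2) h2
    exact hasDepthGE_succ_iff.2 ⟨z, hz, hz2, h3.congr (QuotSMulTop.commEquiv M z x)⟩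

section Exact

variable {K G M : Type v} [AddCommGroup K] [AddCommGroup G] [AddCommGroup M]
  [Module S K] [Module S G] [Module S M]

theorem QuotSMulTop.map_injective_of_exact {f : K →ₗ[S] G} {g : G →ₗ[S] M} {z : S}
    (hf : Function.Injective f) (hfg : Function.Exact f g) (hz : IsSMulRegular M z) :
    Function.Injective (QuotSMulTop.map z f) := by
  rw [← LinearMap.ker_eq_bot, LinearMap.ker_eq_bot']
  intro m hm
  obtain ⟨m, rfl⟩ := Submodule.Quotient.mk_surjective _ m
  rw [QuotSMulTop.map_apply_mk, QuotSMulTop.mk_eq_zero_iff] at hm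
  obtain ⟨b, hb⟩ := hm
  have h0 : g b = 0 := hz.right_eq_zero_of_smul (by rw [← map_smul, ← hb, hfg.apply_apply_eq_zero])
  obtain ⟨c, rfl⟩ := (hfg b).1 h0
  exact QuotSMulTop.mk_eq_zero_iff.2 ⟨c, hf (by rw [hb, map_smul])⟩

/-- The depth lemma without homological algebra: divide by an element regular on all three modules.
It exists because M is socle-free: if 𝔫 b lies in K, then x b represents a socle element of K/xK,
which is zero, so b itself lies in K. -/
theorem HasDepthGE.of_exact_right [IsNoetherianRing S] {n : ℕ} : ∀ {K G M : Type v} [AddCommGroup K] [AddCommGroup G]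
    [AddCommGroup M] [Module S K] [Module S G] [Module S M] [Module.Finite S K]
    [Module.Finite S G] [Module.Finite S M] (f : K →ₗ[S] G) (g : G →ₗ[S] M),
    Function.Injective f → Function.Exact f g → Function.Surjective g →
    HasDepthGE 𝔫 K (n + 1) → HasDepthGE 𝔫 G (n + 1) → HasDepthGE 𝔫 M n := by
  induction n with
  | zero => intros; exact hasDepthGE_zero _
  | succ n ih =>
    intro K G M _ _ _ _ _ _ _ _ _ f g hf hfg hg hK hG
    obtain ⟨x, hx, hxG, -⟩ := hasDepthGE_succ_iff.1 hG
    have hxK : IsSMulRegular K x := hxG.of_injective f hf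
    have hs := SocleFree.of_hasDepthGE (hK.quotSMulTop hx hxK)
    have hsM : SocleFree 𝔫 M := by
      intro m hm
      obtain ⟨b, rfl⟩ := hg m
      have hk : ∀ a ∈ 𝔫, ∃ c, f c = a • b := fun a ha => (hfg (a • b)).1 (by rw [map_smul, hm a ha])
      obtain ⟨c, hc⟩ := hk x hx
      have : (Submodule.Quotient.mk c : QuotSMulTop x K) = 0 := by
        refine hs _ fun a ha => ?_
        obtain ⟨e, he⟩ := hk a ha
        rw [← Submodule.Quotient.mk_smul, QuotSMulTop.mk_eq_zero_iff]
        exact ⟨e, hf (by rw [map_smul, map_smul, hc, he, smul_comm])⟩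
      obtain ⟨e, rfl⟩ := QuotSMulTop.mk_eq_zero_iff.1 this
      have : f e = b := hxG (by change x • f e = x • b; rw [← hc, map_smul])
      rw [← this, hfg.apply_apply_eq_zero]
    obtain ⟨z, hz, hzreg⟩ := ((SocleFree.of_hasDepthGE hK).prod
      ((SocleFree.of_hasDepthGE hG).prod hsM)).exists_isSMulRegular
    have hz1 := hzreg.of_prod_left
    have hz2 := hzreg.of_prod_right.of_prod_left
    have hz3 := hzreg.of_prod_right.of_prod_right
    exact hasDepthGE_succ_iff.2 ⟨z, hz, hz3, ih (QuotSMulTop.map z f) (QuotSMulTop.map z g)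
      (QuotSMulTop.map_injective_of_exact hf hfg hz3) (QuotSMulTop.map_exact z hfg hg)
      (QuotSMulTop.map_surjective z hg) (hK.quotSMulTop hz hz1) (hG.quotSMulTop hz hz2)⟩

theorem HasDepthGE.of_exact_middle [IsNoetherianRing S] {n : ℕ} : ∀ {K G M : Type v} [AddCommGroup K] [AddCommGroup G]
    [AddCommGroup M] [Module S K] [Module S G] [Module S M] [Module.Finite S K]
    [Module.Finite S G] [Module.Finite S M] (f : K →ₗ[S] G) (g : G →ₗ[S] M),
    Function.Injective f → Function.Exact f g → Function.Surjective g →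
    HasDepthGE 𝔫 K n → HasDepthGE 𝔫 M n → HasDepthGE 𝔫 G n := by
  induction n with
  | zero => intros; exact hasDepthGE_zero _
  | succ n ih =>
    intro K G M _ _ _ _ _ _ _ _ _ f g hf hfg hg hK hM
    obtain ⟨z, hz, hzreg⟩ := ((SocleFree.of_hasDepthGE hK).prod
      (SocleFree.of_hasDepthGE hM)).exists_isSMulRegular
    have hz1 := hzreg.of_prod_left
    have hz2 := hzreg.of_prod_right
    refine hasDepthGE_succ_iff.2 ⟨z, hz, isSMulRegular_of_range_eq_ker hf
      (LinearMap.exact_iff.1 hfg).symm hz1 hz2, ih (QuotSMulTop.map z f) (QuotSMulTop.map z g)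
      (QuotSMulTop.map_injective_of_exact hf hfg hz2) (QuotSMulTop.map_exact z hfg hg)
      (QuotSMulTop.map_surjective z hg) (hK.quotSMulTop hz hz1) (hM.quotSMulTop hz hz2)⟩

end Exact

end DepthTheory

/-! ### Systems of parameters in Cohen–Macaulay local rings -/

section LocalDepth

open RingTheory.Sequence

variable {R : Type u} [CommRing R] [IsLocalRing R] [IsNoetherianRing R]

/-- The depth of a finite module is at most the dimension of `R ⧸ P`, for each associated prime
`P`. -/
theorem HasDepthGE.le_ringKrullDim_quotient {n : ℕ} : ∀ {M : Type v} [AddCommGroup M] [Module R M]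
    [Module.Finite R M] {P : Ideal R}, P ∈ associatedPrimes R M →
    HasDepthGE (maximalIdeal R) M n → (n : WithBot ℕ∞) ≤ ringKrullDim (R ⧸ P) := by
  induction n with
  | zero =>
    intro M _ _ _ P hP _
    have := Ideal.Quotient.nontrivial_iff.2 (IsAssociatedPrime.isPrime hP).ne_top
    simpa using ringKrullDim_nonneg_of_nontrivial
  | succ n ih =>
    intro M _ _ _ P hP hd
    obtain ⟨z, hz, hreg, hd⟩ := hasDepthGE_succ_iff.1 hd
    obtain ⟨hPp, m₀, hm₀⟩ := (isAssociatedPrime_iff).1 hP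
    have hzP : z ∉ P := by
      intro hzP
      rw [hm₀, Submodule.mem_colon_singleton, Submodule.mem_bot] at hzP
      have h0 := hreg.right_eq_zero_of_smul hzP
      refine hPp.ne_top ((Ideal.eq_top_iff_one _).2 ?_)
      rw [hm₀, Submodule.mem_colon_singleton, h0]
      simp
    -- N is the submodule killed by P. If N were contained in zM, regularity of z would give N = zN,
    -- and N = 0 by Nakayama. So some m in N survives in M/zM, and an associated prime Q of its span
    -- contains both P and z.
    let N : Submodule R M :=
      { carrier := {m | ∀ p ∈ P, p • m = 0}
        zero_mem' := fun p _ => smul_zero p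
        add_mem' := fun {a b} ha hb p hp => by rw [smul_add, ha p hp, hb p hp, add_zero]
        smul_mem' := fun c m hm p hp => by rw [smul_comm, hm p hp, smul_zero] }
    have hN : N ≠ ⊥ := by
      intro hN
      have : m₀ ∈ N := fun p hp => by
        rwa [hm₀, Submodule.mem_colon_singleton, Submodule.mem_bot] at hp
      rw [hN, Submodule.mem_bot] at this
      refine hPp.ne_top ((Ideal.eq_top_iff_one _).2 ?_)
      rw [hm₀, Submodule.mem_colon_singleton, this]
      simp
    obtain ⟨m, hmN, hmz⟩ : ∃ m ∈ N, ∀ m', m ≠ z • m' := by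
      by_contra! hcon
      refine hN (Submodule.eq_bot_of_le_smul_of_le_jacobson_bot (Ideal.span {z}) N
        (IsNoetherian.noetherian N) ?_ ?_)
      · intro m hm
        obtain ⟨m', rfl⟩ := hcon m hm
        refine Submodule.smul_mem_smul (Ideal.mem_span_singleton_self z) fun p hp => ?_
        exact hreg.right_eq_zero_of_smul (by rw [smul_comm, hm p hp])
      · rw [IsLocalRing.jacobson_eq_maximalIdeal _ bot_ne_top, Ideal.span_singleton_le_iff_mem]
        exact hz
    have hne : (Submodule.Quotient.mk m : QuotSMulTop z M) ≠ 0 := fun h => by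
      obtain ⟨m', hm'⟩ := QuotSMulTop.mk_eq_zero_iff.1 h
      exact hmz m' hm'
    obtain ⟨Q, hQ, hle⟩ := exists_le_isAssociatedPrime_of_isNoetherianRing R
      (Submodule.Quotient.mk m : QuotSMulTop z M) hne
    have hmem : ∀ a : R, (∃ m', a • m = z • m') → a ∈ Q := fun a ⟨m', h⟩ => hle (by
      rw [Submodule.mem_colon_singleton, Submodule.mem_bot, ← Submodule.Quotient.mk_smul,
        QuotSMulTop.mk_eq_zero_iff]
      exact ⟨m', h⟩)
    have hPQ : P ≤ Q := fun p hp => hmem p ⟨0, by rw [hmN p hp, smul_zero]⟩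
    have h1 := ih hQ hd
    have h2 : ringKrullDim (R ⧸ Q) + 1 ≤ ringKrullDim (R ⧸ P) := by
      refine ringKrullDim_succ_le_of_surjective (Ideal.Quotient.factor hPQ)
        (Ideal.Quotient.factor_surjective hPQ) (r := Ideal.Quotient.mk P z) ?_ ?_
      · exact mem_nonZeroDivisors_of_ne_zero fun h => hzP (Ideal.Quotient.eq_zero_iff_mem.1 h)
      · rw [Ideal.Quotient.factor_mk]
        exact Ideal.Quotient.eq_zero_iff_mem.2 (hmem z ⟨m, rfl⟩)
    refine le_trans ?_ h2
    push_cast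
    gcongr

/-- If the first element lay in an associated prime P, the remaining ones would already generate an
ideal primary to the maximal ideal of R/P. By Krull's height theorem dim R/P would be smaller than
the length of the sequence, against the depth bound. -/
theorem isWeaklyRegular_of_hasDepthGE_length : ∀ (rs : List R) {M : Type v} [AddCommGroup M]
    [Module R M] [Module.Finite R M], HasDepthGE (maximalIdeal R) M rs.length →
    (∀ r ∈ rs, r ∈ maximalIdeal R) →
    (∀ P : Ideal R, P.IsPrime → Module.annihilator R M ≤ P → (∀ r ∈ rs, r ∈ P) →
      P = maximalIdeal R) → IsWeaklyRegular M rs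
  | [], M, _, _, _, _, _, _ => IsWeaklyRegular.nil R M
  | x :: rs, M, _, _, _, hd, hm, H => by
    have hxm := hm x (by simp)
    have hreg : IsSMulRegular M x := by
      by_contra hreg
      have hx : x ∈ {r : R | IsSMulRegular M r}ᶜ := hreg
      rw [← biUnion_associatedPrimes_eq_compl_regular R] at hx
      simp only [Set.mem_iUnion, SetLike.mem_coe, exists_prop] at hx
      obtain ⟨P, hP, hxP⟩ := hx
      have hPp : P.IsPrime := IsAssociatedPrime.isPrime hP
      have h1 := hd.le_ringKrullDim_quotient hP
      have : Nontrivial (R ⧸ P) := Ideal.Quotient.nontrivial_iff.2 hPp.ne_top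
      have : IsLocalRing (R ⧸ P) := .of_surjective' (Ideal.Quotient.mk P)
        Ideal.Quotient.mk_surjective
      classical
      let s : Finset (R ⧸ P) := (rs.map (Ideal.Quotient.mk P)).toFinset
      have hmin : maximalIdeal (R ⧸ P) ∈ (Ideal.span (s : Set (R ⧸ P))).minimalPrimes := by
        have key : ∀ Q : Ideal (R ⧸ P), Q.IsPrime → Ideal.span (s : Set (R ⧸ P)) ≤ Q →
            maximalIdeal (R ⧸ P) ≤ Q := by
          intro Q hQ hsQ
          have hcomap : Q.comap (Ideal.Quotient.mk P) = maximalIdeal R := by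
            refine H _ inferInstance ?_ ?_
            · refine (Submodule.annihilator_top (R := R) (M := M) ▸
                IsAssociatedPrime.annihilator_le hP : Module.annihilator R M ≤ P).trans ?_
              intro p hp
              rw [Ideal.mem_comap, Ideal.Quotient.eq_zero_iff_mem.2 hp]
              exact Q.zero_mem
            · intro r hr
              rw [Ideal.mem_comap]
              rcases List.mem_cons.1 hr with rfl | hr
              · rw [Ideal.Quotient.eq_zero_iff_mem.2 hxP]
                exact Q.zero_mem
              · exact hsQ (Ideal.subset_span (by simpa [s] using ⟨r, hr, rfl⟩))
          intro y hy
          obtain ⟨y, rfl⟩ := Ideal.Quotient.mk_surjective y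
          rw [← Ideal.mem_comap, hcomap, mem_maximalIdeal, mem_nonunits_iff]
          exact fun hu => (mem_nonunits_iff.1 ((mem_maximalIdeal _).1 hy)) (hu.map _)
        refine ⟨⟨inferInstance, ?_⟩, fun Q hQ _ => key Q hQ.1 hQ.2⟩
        rw [Ideal.span_le]
        intro y hy
        simp only [s, List.coe_toFinset, List.mem_map, Set.mem_ofPred_eq] at hy
        obtain ⟨r, hr, rfl⟩ := hy
        refine (mem_maximalIdeal _).2 (mem_nonunits_iff.2 fun hu => ?_)
        obtain ⟨v, hv⟩ := hu.exists_right_inv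
        obtain ⟨v, rfl⟩ := Ideal.Quotient.mk_surjective v
        rw [← map_mul, ← map_one (Ideal.Quotient.mk P), Ideal.Quotient.eq] at hv
        have h2 := le_maximalIdeal hPp.ne_top hv
        have h3 := (maximalIdeal R).mul_mem_right v (hm r (List.mem_cons_of_mem _ hr))
        have := (maximalIdeal R).sub_mem h3 h2
        rw [sub_sub_cancel] at this
        exact (Ideal.ne_top_iff_one _).1 (maximalIdeal.isMaximal R).ne_top this
      have h2 := Ideal.height_le_card_of_mem_minimalPrimes_span_finset hmin
      have h3 : s.card ≤ rs.length := (List.toFinset_card_le _).trans (by simp)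
      rw [← IsLocalRing.maximalIdeal_height_eq_ringKrullDim] at h1
      have h4 : (((x :: rs).length : ℕ) : ℕ∞) ≤ s.card := (WithBot.coe_le_coe.1 h1).trans h2
      have h5 : (x :: rs).length ≤ s.card := by exact_mod_cast h4
      simp at h5
      omega
    refine IsWeaklyRegular.cons hreg (isWeaklyRegular_of_hasDepthGE_length rs
      (hd.quotSMulTop hxm hreg) (fun r hr => hm r (List.mem_cons_of_mem _ hr)) ?_)
    intro P hP hann hrs
    refine H P hP ?_ ?_
    · exact (LinearMap.annihilator_le_of_surjective _ (Submodule.mkQ_surjective _)).trans hann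
    · intro r hr
      rcases List.mem_cons.1 hr with rfl | hr
      exacts [hann (QuotSMulTop.mem_annihilator M r), hrs r hr]

/-- In a Cohen-Macaulay local ring of dimension `d`, a regular sequence of length `d` exists. -/
theorem IsCohenMacaulayLocalRing.hasDepthGE {R : Type u} [CommRing R] [IsLocalRing R]
    (hR : IsCohenMacaulayLocalRing R) {d : ℕ} (hdim : ringKrullDim R = (d : WithBot ℕ∞)) :
    HasDepthGE (maximalIdeal R) R d := by
  have h := hR.depth_eq_dim
  rw [hdim] at h
  have h : idealDepth (maximalIdeal R) R = d := by exact_mod_cast h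
  rcases Nat.eq_zero_or_pos d with rfl | hd
  · exact hasDepthGE_zero _
  by_contra hno
  have hle : idealDepth (maximalIdeal R) R ≤ ((d - 1 : ℕ) : ℕ∞) := by
    refine iSup_le fun ⟨rs, hm, hreg⟩ => ?_
    have : rs.length < d := by
      by_contra! hlt
      refine hno ⟨rs.take d, by simpa using hlt, fun r hr => hm r (List.mem_of_mem_take hr), ?_⟩
      have := hreg.toIsWeaklyRegular
      rw [← List.take_append_drop d rs, isWeaklyRegular_append_iff] at this
      exact this.1
    exact_mod_cast Nat.le_sub_one_of_lt this
  rw [h] at hle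
  have : d ≤ d - 1 := by exact_mod_cast hle
  omega

end LocalDepth

/-! ### Regular sequences are quasi-regular -/

section QuasiRegular

open MvPolynomial

variable {R : Type u} [CommRing R] {σ : Type*} {x : σ → R}

theorem MvPolynomial.eval_mem_mul_pow {s : Set σ} {𝔞 : Ideal R} {n : ℕ} {p : MvPolynomial σ R}
    (hp : p.IsHomogeneous n) (hs : p ∈ supported R s) (h𝔞 : ∀ m, coeff m p ∈ 𝔞) :
    eval x p ∈ 𝔞 * Ideal.span (x '' s) ^ n := by
  rw [eval_eq]
  refine Ideal.sum_mem _ fun m hm => Ideal.mul_mem_mul (h𝔞 m) ?_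
  have hdeg : ∑ i ∈ m.support, m i = n := (hp.degree_eq_sum_deg_support hm).symm
  rw [← hdeg, ← Finset.prod_pow_eq_pow_sum]
  exact Ideal.prod_mem_prod fun i hi => Ideal.pow_mem_pow (Ideal.subset_span
    (Set.mem_image_of_mem x (mem_supported.1 hs ((mem_vars_iff_mem_support i).2 ⟨m, hm, hi⟩)))) _

theorem MvPolynomial.exists_eval_eq_of_mem_mul_pow {s : Set σ} {𝔞 : Ideal R} {n : ℕ} {y : R}
    (hy : y ∈ 𝔞 * Ideal.span (x '' s) ^ n) :
    ∃ p : MvPolynomial σ R, p.IsHomogeneous n ∧ p ∈ supported R s ∧ (∀ m, coeff m p ∈ 𝔞) ∧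
      eval x p = y := by
  refine Submodule.mul_induction_on hy ?_ ?_
  · intro a ha b hb
    rw [Set.image_eq_range, Ideal.mem_span_pow_iff_exists_isHomogeneous] at hb
    obtain ⟨q, hq, rfl⟩ := hb
    refine ⟨C a * rename Subtype.val q, (hq.rename_isHomogeneous).C_mul a, ?_, ?_, ?_⟩
    · refine Subalgebra.mul_mem _ (Subalgebra.algebraMap_mem _ a) ?_
      rw [supported_eq_range_rename]
      exact ⟨q, rfl⟩
    · intro m
      rw [coeff_C_mul]
      exact 𝔞.mul_mem_right _ ha
    · rw [map_mul, eval_C, eval_rename]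
      rfl
  · rintro _ _ ⟨p, h1, h2, h3, rfl⟩ ⟨q, h1', h2', h3', rfl⟩
    exact ⟨p + q, h1.add h1', Subalgebra.add_mem _ h2 h2',
      fun m => by rw [coeff_add]; exact 𝔞.add_mem (h3 m) (h3' m), map_add _ _ _⟩

/-- The forms in the variables `s` that vanish at `x` have coefficients in the ideal generated by
`x '' s`. -/
def QuasiRegularOn (x : σ → R) (s : Set σ) (n : ℕ) : Prop :=
  ∀ p : MvPolynomial σ R, p.IsHomogeneous n → p ∈ supported R s → eval x p = 0 →
    ∀ m, coeff m p ∈ Ideal.span (x '' s)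

theorem QuasiRegularOn.coeff_mem {s : Set σ} {n : ℕ} (h : QuasiRegularOn x s n) {𝔞 : Ideal R}
    (h𝔞 : Ideal.span (x '' s) ≤ 𝔞)
    {p : MvPolynomial σ R} (hp : p.IsHomogeneous n) (hs : p ∈ supported R s)
    (he : eval x p ∈ 𝔞 * Ideal.span (x '' s) ^ n) (m : σ →₀ ℕ) : coeff m p ∈ 𝔞 := by
  obtain ⟨q, hq, hqs, hqJ, hqe⟩ := exists_eval_eq_of_mem_mul_pow he
  have := h (p - q) (hp.sub hq) (Subalgebra.sub_mem _ hs hqs) (by rw [map_sub, hqe, sub_self]) m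
  rw [coeff_sub] at this
  simpa using Ideal.add_mem _ (h𝔞 this) (hqJ m)

/-- Raise the power one step at a time: if y = q(x) with q of degree n and a y lies in the next
power, the coefficients of a q lie in the ideal, hence so do those of q. -/
theorem QuasiRegularOn.mem_pow_of_mul_mem {s : Set σ} (h : ∀ n, QuasiRegularOn x s n) {a : R}
    (ha : ∀ r, a * r ∈ Ideal.span (x '' s) → r ∈ Ideal.span (x '' s)) {n : ℕ} {y : R}
    (hy : a * y ∈ Ideal.span (x '' s) ^ n) : y ∈ Ideal.span (x '' s) ^ n := by
  induction n with
  | zero => simp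
  | succ n ih =>
    have hyn := ih (Ideal.pow_le_pow_right n.le_succ hy)
    rw [← one_mul (Ideal.span (x '' s) ^ n), Ideal.one_eq_top] at hyn
    obtain ⟨q, hq, hqs, -, rfl⟩ := exists_eval_eq_of_mem_mul_pow hyn
    rw [pow_succ'] at hy ⊢
    refine eval_mem_mul_pow hq hqs fun m => ha _ ?_
    rw [← coeff_C_mul]
    refine (h n).coeff_mem le_rfl (hq.C_mul a)
      (Subalgebra.mul_mem _ (Subalgebra.algebraMap_mem _ a) hqs) ?_ m
    rwa [map_mul, eval_C]

/-- Write a vanishing form as X_i g + q with q free of X_i. Then x_i g(x) = -q(x), so g(x) lies in a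
power of the old ideal one higher than the degree of g. Induction on the degree handles g. -/
theorem quasiRegularOn_insert {s : Set σ} (h : ∀ n, QuasiRegularOn x s n) {i : σ}
    (ha : ∀ r, x i * r ∈ Ideal.span (x '' s) → r ∈ Ideal.span (x '' s)) (n : ℕ) :
    QuasiRegularOn x (insert i s) n := by
  classical
  have hle : Ideal.span (x '' s) ≤ Ideal.span (x '' insert i s) :=
    Ideal.span_mono (Set.image_mono (Set.subset_insert i s))
  have hi : x i ∈ Ideal.span (x '' insert i s) := Ideal.subset_span ⟨i, by simp, rfl⟩
  induction n with
  | zero =>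
    intro p hp hs he m
    have : p = C (coeff 0 p) := by
      rw [← homogeneousComponent_zero, homogeneousComponent_eq_self hp]
    rw [this, eval_C] at he
    rw [this, he, map_zero, coeff_zero]
    exact Ideal.zero_mem _
  | succ n ih =>
    intro p hp hs he m
    set g := p.divMonomial (Finsupp.single i 1) with hg
    set q := p.modMonomial (Finsupp.single i 1) with hq
    have hpgq : p = X i * g + q := (divMonomial_add_modMonomial_single p i).symm
    have hgh : g.IsHomogeneous n := by
      intro m hm
      rw [hg, coeff_divMonomial] at hm
      have := hp hm
      rw [map_add] at this
      simp only [Finsupp.weight_single, Pi.one_apply, smul_eq_mul, mul_one] at this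
      omega
    have hqh : q.IsHomogeneous (n + 1) := by
      have : q = p - X i * g := by rw [hpgq]; ring
      rw [this]
      refine hp.sub ?_
      rw [add_comm n 1]
      exact (isHomogeneous_X R i).mul hgh
    have hgs : g ∈ supported R (insert i s) := by
      rw [mem_supported]
      intro j hj
      obtain ⟨m, hm, hj⟩ := (mem_vars_iff_mem_support j).1 hj
      rw [mem_support_iff, hg, coeff_divMonomial, ← mem_support_iff] at hm
      refine mem_supported.1 hs ((mem_vars_iff_mem_support j).2 ⟨_, hm, ?_⟩)
      rw [Finsupp.mem_support_iff] at hj ⊢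
      rw [Finsupp.add_apply]
      omega
    have hqs : q ∈ supported R s := by
      rw [mem_supported]
      intro j hj
      obtain ⟨m, hm, hj'⟩ := (mem_vars_iff_mem_support j).1 hj
      rw [mem_support_iff] at hm
      have hmi : ¬ Finsupp.single i 1 ≤ m := fun hle => hm (coeff_modMonomial_of_le p hle)
      rw [hq, coeff_modMonomial_of_not_le p hmi, ← mem_support_iff] at hm
      rcases mem_supported.1 hs ((mem_vars_iff_mem_support j).2 ⟨_, hm, hj'⟩) with rfl | h
      · exact absurd (Finsupp.single_le_iff.2 (Nat.one_le_iff_ne_zero.2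
          (Finsupp.mem_support_iff.1 hj'))) hmi
      · exact h
    have hqe : eval x q ∈ Ideal.span (x '' s) ^ (n + 1) := by
      have := eval_mem_mul_pow (x := x) (𝔞 := ⊤) hqh hqs (by simp)
      rwa [← Ideal.one_eq_top, one_mul] at this
    have hge : eval x g ∈ Ideal.span (x '' s) ^ (n + 1) := by
      refine QuasiRegularOn.mem_pow_of_mul_mem h ha ?_
      have : x i * eval x g = - eval x q := by
        rw [hpgq, map_add, map_mul, eval_X] at he
        exact eq_neg_of_add_eq_zero_left he
      rw [this]
      exact neg_mem hqe
    have hgc : ∀ m, coeff m g ∈ Ideal.span (x '' insert i s) := fun m =>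
      ih.coeff_mem le_rfl hgh hgs (by rw [← pow_succ']; exact Ideal.pow_right_mono hle _ hge) m
    have hqc : coeff m q ∈ Ideal.span (x '' insert i s) := by
      rw [← one_mul (Ideal.span (x '' s) ^ (n + 1)), Ideal.one_eq_top] at hge
      -- Rewriting g(x) as H(x) in the old variables makes q + x_i H a vanishing form in those
      -- variables alone.
      obtain ⟨H, hH, hHs, -, hHe⟩ := exists_eval_eq_of_mem_mul_pow hge
      have := h _ (q + C (x i) * H) (hqh.add (hH.C_mul _)) (Subalgebra.add_mem _ hqs
        (Subalgebra.mul_mem _ (Subalgebra.algebraMap_mem _ _) hHs)) (by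
          rw [map_add, map_mul, eval_C, hHe, ← he, hpgq, map_add, map_mul, eval_X]; ring) m
      rw [coeff_add, coeff_C_mul] at this
      have := Ideal.sub_mem _ (hle this) (Ideal.mul_mem_right (coeff m H) _ hi)
      rwa [add_sub_cancel_right] at this
    rw [hpgq, coeff_add, coeff_X_mul']
    refine Ideal.add_mem _ ?_ hqc
    split_ifs
    exacts [hgc _, Ideal.zero_mem _]

/-- The family `x` is quasi-regular. -/
def QuasiRegular (x : σ → R) : Prop := ∀ n, QuasiRegularOn x Set.univ n

theorem quasiRegular_of_forall_fin {d : ℕ} {x : Fin d → R}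
    (h : ∀ i r, x i * r ∈ Ideal.span (x '' {j | j < i}) → r ∈ Ideal.span (x '' {j | j < i})) :
    QuasiRegular x := by
  have key : ∀ k ≤ d, ∀ n, QuasiRegularOn x {j : Fin d | j.val < k} n := by
    intro k
    induction k with
    | zero =>
      intro _ n p hp hs he m
      have h0 : {j : Fin d | j.val < 0} = ∅ := by ext; simp
      rw [h0, supported_empty] at hs
      obtain ⟨c, rfl⟩ := Algebra.mem_bot.1 hs
      have : c = 0 := by simpa using he
      rw [this, map_zero, coeff_zero]
      exact Ideal.zero_mem _
    | succ k ih =>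
      intro hk n
      have : {j : Fin d | j.val < k + 1} = insert (⟨k, hk⟩ : Fin d) {j : Fin d | j.val < k} := by
        ext j
        simp [Fin.ext_iff]
        omega
      rw [this]
      exact quasiRegularOn_insert (ih (by omega)) (h ⟨k, hk⟩) n
  intro n
  have : (Set.univ : Set (Fin d)) = {j : Fin d | j.val < d} := by ext j; simp
  rw [this]
  exact key d le_rfl n

end QuasiRegular

/-! ### Forms with a unit coefficient over a local ring -/

section LocalForms

open MvPolynomial

variable {R : Type u} [CommRing R] {d : ℕ} {x : Fin d → R}

theorem MvPolynomial.eval_mem_mul_span_range_pow {𝔞 : Ideal R} {n : ℕ} {p : MvPolynomial (Fin d) R}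
    (hp : p.IsHomogeneous n) (h𝔞 : ∀ m, coeff m p ∈ 𝔞) :
    eval x p ∈ 𝔞 * Ideal.span (Set.range x) ^ n := by
  rw [← Set.image_univ]
  exact eval_mem_mul_pow hp (by rw [supported_univ]; trivial) h𝔞

theorem MvPolynomial.eval_mem_span_range_pow {n : ℕ} {p : MvPolynomial (Fin d) R}
    (hp : p.IsHomogeneous n) : eval x p ∈ Ideal.span (Set.range x) ^ n :=
  (Ideal.mem_span_pow_iff_exists_isHomogeneous x _).2 ⟨p, hp, rfl⟩

theorem MvPolynomial.exists_eval_eq_of_mem_mul_span_range_pow {𝔞 : Ideal R} {n : ℕ} {y : R}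
    (hy : y ∈ 𝔞 * Ideal.span (Set.range x) ^ n) :
    ∃ p : MvPolynomial (Fin d) R, p.IsHomogeneous n ∧ (∀ m, coeff m p ∈ 𝔞) ∧ eval x p = y := by
  rw [← Set.image_univ] at hy
  obtain ⟨p, h1, -, h2, h3⟩ := exists_eval_eq_of_mem_mul_pow hy
  exact ⟨p, h1, h2, h3⟩

theorem MvPolynomial.exists_eval_eq_of_mem_span_range_pow {n : ℕ} {y : R}
    (hy : y ∈ Ideal.span (Set.range x) ^ n) :
    ∃ p : MvPolynomial (Fin d) R, p.IsHomogeneous n ∧ eval x p = y :=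
  (Ideal.mem_span_pow_iff_exists_isHomogeneous x y).1 hy

theorem QuasiRegular.coeff_mem (h : QuasiRegular x) {𝔞 : Ideal R}
    (h𝔞 : Ideal.span (Set.range x) ≤ 𝔞) {n : ℕ} {p : MvPolynomial (Fin d) R}
    (hp : p.IsHomogeneous n) (he : eval x p ∈ 𝔞 * Ideal.span (Set.range x) ^ n)
    (m : Fin d →₀ ℕ) : coeff m p ∈ 𝔞 := by
  rw [← Set.image_univ] at he h𝔞
  exact (h n).coeff_mem h𝔞 hp (by rw [supported_univ]; trivial) he m

variable [IsLocalRing R]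

/-- A polynomial with a unit coefficient is a nonzerodivisor modulo any ideal. -/
theorem MvPolynomial.coeff_mem_of_mul_coeff_mem {𝔟 : Ideal R} {f p : MvPolynomial (Fin d) R}
    (hf : ∃ m, coeff m f ∉ maximalIdeal R) (h : ∀ m, coeff m (f * p) ∈ 𝔟) (m : Fin d →₀ ℕ) :
    coeff m p ∈ 𝔟 := by
  classical
  -- 𝔠 is the content ideal of p. By Nakayama, it is enough to place the coefficients of p in 𝔟 +
  -- 𝔪𝔠.
  let 𝔠 : Ideal R := Ideal.span (p.support.image fun m => coeff m p : Finset R)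
  have h𝔠 : ∀ m, coeff m p ∈ 𝔠 := by
    intro m
    by_cases hm : m ∈ p.support
    · exact Ideal.subset_span (by simpa using ⟨m, by simpa using hm, rfl⟩)
    · rw [notMem_support_iff.1 hm]
      exact 𝔠.zero_mem
  let ord := MonomialOrder.lex (σ := Fin d)
  have key : ∀ m, coeff m p ∈ 𝔟 ⊔ maximalIdeal R * 𝔠 := by
    by_contra! hcon
    let A := f.support.filter fun m => coeff m f ∉ maximalIdeal R
    let B := p.support.filter fun m => coeff m p ∉ 𝔟 ⊔ maximalIdeal R * 𝔠
    have hA : ∀ m, m ∈ A ↔ coeff m f ∉ maximalIdeal R := fun m => by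
      simp only [A, Finset.mem_filter, mem_support_iff, and_iff_right_iff_imp]
      intro h h0
      exact h (h0 ▸ Ideal.zero_mem _)
    have hB : ∀ m, m ∈ B ↔ coeff m p ∉ 𝔟 ⊔ maximalIdeal R * 𝔠 := fun m => by
      simp only [B, Finset.mem_filter, mem_support_iff, and_iff_right_iff_imp]
      intro h h0
      exact h (h0 ▸ Ideal.zero_mem _)
    -- A Gauss lemma argument: for α maximal among the unit coefficients of f and β maximal among
    -- the bad coefficients of p, every other product contributing to the coefficient at α + β lies
    -- in 𝔟 + 𝔪𝔠.
    obtain ⟨α, hαA, hα⟩ := A.exists_max_image ord.toSyn (hf.imp fun m => (hA m).2)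
    obtain ⟨β, hβB, hβ⟩ := B.exists_max_image ord.toSyn (hcon.imp fun m => (hB m).2)
    have hsum := h (α + β)
    rw [coeff_mul, ← Finset.add_sum_erase _ _ (Finset.HasAntidiagonal.mem_antidiagonal.2
      (rfl : (α, β).1 + (α, β).2 = α + β))] at hsum
    have hrest : ∑ ab ∈ (Finset.HasAntidiagonal.antidiagonal (α + β)).erase (α, β), coeff ab.1 f * coeff ab.2 p ∈
        𝔟 ⊔ maximalIdeal R * 𝔠 := by
      refine Ideal.sum_mem _ ?_
      rintro ⟨a, b⟩ hab
      rw [Finset.mem_erase, Finset.HasAntidiagonal.mem_antidiagonal] at hab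
      obtain ⟨hne, hab⟩ := hab
      dsimp only at hab ⊢
      by_cases ha : a ∈ A
      · have h1 := hα a ha
        have h2 : b ∉ B := by
          intro hb
          have h2 := hβ b hb
          have h3 : ord.toSyn a + ord.toSyn b = ord.toSyn α + ord.toSyn β := by
            rw [← map_add, hab, map_add]
          have h4 : ord.toSyn a = ord.toSyn α := by
            by_contra h
            exact absurd h3 (add_lt_add_of_lt_of_le (lt_of_le_of_ne h1 h) h2).ne
          have h5 : a = α := ord.toSyn.injective h4
          subst h5
          exact hne (by rw [add_left_cancel hab])
        rw [hB, not_not] at h2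
        exact Ideal.mul_mem_left _ _ h2
      · rw [hA, not_not] at ha
        exact Ideal.mem_sup_right (Ideal.mul_mem_mul ha (h𝔠 b))
    have hmem := Ideal.sub_mem _ (Ideal.mem_sup_left (T := maximalIdeal R * 𝔠) hsum) hrest
    rw [add_sub_cancel_right] at hmem
    have hu : IsUnit (coeff α f) := by simpa using (hA α).1 hαA
    exact (hB β).1 hβB ((Ideal.unit_mul_mem_iff_mem _ hu).1 hmem)
  have hle : 𝔠 ≤ 𝔟 := by
    refine Submodule.le_of_le_smul_of_le_jacobson_bot (I := maximalIdeal R)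
      (Submodule.fg_span (Finset.finite_toSet _))
      (IsLocalRing.jacobson_eq_maximalIdeal ⊥ bot_ne_top).ge ?_
    rw [Ideal.span_le]
    intro c hc
    simp only [Finset.coe_image, Set.mem_image] at hc
    obtain ⟨m, -, rfl⟩ := hc
    exact key m
  exact hle (h𝔠 m)

theorem MvPolynomial.exists_coeff_mul_notMem {f g : MvPolynomial (Fin d) R}
    (hf : ∃ m, coeff m f ∉ maximalIdeal R) (hg : ∃ m, coeff m g ∉ maximalIdeal R) :
    ∃ m, coeff m (f * g) ∉ maximalIdeal R := by
  by_contra! h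
  obtain ⟨m, hm⟩ := hg
  exact hm (coeff_mem_of_mul_coeff_mem hf h m)

/-- If `x` is quasi-regular and `J = (x)`, a form of degree `k` with a unit coefficient is a
nonzerodivisor on `⨁ R / J ^ n 𝔞`. -/
theorem QuasiRegular.mem_of_eval_mul_mem (h : QuasiRegular x) {𝔞 : Ideal R}
    (h𝔞 : Ideal.span (Set.range x) ≤ 𝔞) {k n : ℕ} {f : MvPolynomial (Fin d) R}
    (hf : f.IsHomogeneous k) (hfu : ∃ m, coeff m f ∉ maximalIdeal R) {s : R}
    (hs : eval x f * s ∈ 𝔞 * Ideal.span (Set.range x) ^ (k + n)) :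
    s ∈ 𝔞 * Ideal.span (Set.range x) ^ n := by
  have hle : 𝔞 * Ideal.span (Set.range x) ^ (k + n) ≤ Ideal.span (Set.range x) ^ (k + n) :=
    Ideal.mul_le_right
  -- The case of powers of J comes first: s must be written as a form of degree n at x before its
  -- coefficients can be compared with 𝔞.
  have key : ∀ i ≤ n, s ∈ Ideal.span (Set.range x) ^ i := by
    intro i
    induction i with
    | zero => simp
    | succ i ih =>
      intro hi
      obtain ⟨p, hp, rfl⟩ := exists_eval_eq_of_mem_span_range_pow (ih (by omega))
      rw [pow_succ']
      refine eval_mem_mul_span_range_pow hp (coeff_mem_of_mul_coeff_mem hfu ?_)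
      refine h.coeff_mem le_rfl (hf.mul hp) ?_
      rw [map_mul, ← pow_succ']
      exact Ideal.pow_le_pow_right (by omega) (hle hs)
  obtain ⟨p, hp, rfl⟩ := exists_eval_eq_of_mem_span_range_pow (key n le_rfl)
  refine eval_mem_mul_span_range_pow hp (coeff_mem_of_mul_coeff_mem hfu ?_)
  exact h.coeff_mem h𝔞 (hf.mul hp) (by rwa [map_mul])

end LocalForms

/-! ### Minimal reductions and analytic independence -/

section Reductions

open MvPolynomial

variable {R : Type u} [CommRing R] [IsLocalRing R]

/-- Take a generating family of M modulo N of least size: a relation with a unit coefficient would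
make one generator superfluous. -/
theorem exists_independent_generators [IsNoetherianRing R] (M N : Ideal R) :
    ∃ (s : ℕ) (x : Fin s → R), (∀ i, x i ∈ M) ∧ M ≤ Ideal.span (Set.range x) ⊔ N ∧
      ∀ a : Fin s → R, ∑ i, a i * x i ∈ N → ∀ i, a i ∈ maximalIdeal R := by
  classical
  have hex : ∃ (s : ℕ) (x : Fin s → R), (∀ i, x i ∈ M) ∧ M ≤ Ideal.span (Set.range x) ⊔ N := by
    obtain ⟨s, x, hx⟩ := Submodule.fg_iff_exists_fin_generating_family.1 (IsNoetherian.noetherian M)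
    refine ⟨s, x, fun i => hx ▸ Submodule.subset_span ⟨i, rfl⟩, ?_⟩
    exact le_sup_of_le_left hx.ge
  obtain ⟨x, hxM, hM⟩ := Nat.find_spec hex
  have hmin : ∀ m, m < Nat.find hex → _ := fun m => Nat.find_min hex
  generalize Nat.find hex = s at x hmin hM
  refine ⟨s, x, hxM, hM, fun a ha j => ?_⟩
  by_contra hj
  have hu : IsUnit (a j) := by simpa using hj
  obtain _ | s := s
  · exact j.elim0
  refine hmin s s.lt_succ_self ⟨x ∘ j.succAbove, fun i => hxM _, hM.trans (sup_le ?_ le_sup_right)⟩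
  rw [Ideal.span_le]
  rintro _ ⟨i, rfl⟩
  rcases Fin.eq_self_or_eq_succAbove j i with rfl | ⟨i, rfl⟩
  · rw [SetLike.mem_coe, ← Ideal.unit_mul_mem_iff_mem _ hu]
    rw [Fin.sum_univ_succAbove _ i] at ha
    have h1 : ∑ k, a (i.succAbove k) * x (i.succAbove k) ∈
        Ideal.span (Set.range (x ∘ i.succAbove)) :=
      Ideal.sum_mem _ fun k _ => Ideal.mul_mem_left _ _ (Ideal.subset_span ⟨k, rfl⟩)
    have := Ideal.sub_mem _ (Ideal.mem_sup_right (S := Ideal.span (Set.range (x ∘ i.succAbove))) ha)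
      (Ideal.mem_sup_left (T := N) h1)
    rwa [add_sub_cancel_right] at this
  · exact Ideal.mem_sup_left (Ideal.subset_span ⟨i, rfl⟩)

/-- A minimal reduction `J` of `I` is generated by elements that are independent modulo `𝔪 I`. -/
theorem IsMinimalReduction.exists_generators [IsNoetherianRing R] {I J : Ideal R}
    (hJ : IsMinimalReduction J I) : ∃ (s : ℕ) (x : Fin s → R), J = Ideal.span (Set.range x) ∧
      ∀ a : Fin s → R, ∑ i, a i * x i ∈ maximalIdeal R * I → ∀ i, a i ∈ maximalIdeal R := by
  obtain ⟨s, x, hxJ, hle, hind⟩ := exists_independent_generators J (maximalIdeal R * I)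
  obtain ⟨hJI, n, hn⟩ := hJ.prop
  have hKJ : Ideal.span (Set.range x) ≤ J := Ideal.span_le.2 (by rintro _ ⟨i, rfl⟩; exact hxJ i)
  -- Since J ≤ (x) + 𝔪I, Nakayama makes (x) a reduction of I, and minimality then forces J = (x).
  have hred : IsReduction (Ideal.span (Set.range x)) I := by
    refine ⟨hKJ.trans hJI, n, le_antisymm ?_ ?_⟩
    · refine Submodule.le_of_le_smul_of_le_jacobson_bot (I := maximalIdeal R)
        (IsNoetherian.noetherian _) (IsLocalRing.jacobson_eq_maximalIdeal ⊥ bot_ne_top).ge ?_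
      rw [smul_eq_mul]
      calc I ^ (n + 1) = J * I ^ n := hn
        _ ≤ (Ideal.span (Set.range x) ⊔ maximalIdeal R * I) * I ^ n := Ideal.mul_mono_left hle
        _ = _ := by rw [Ideal.sup_mul, mul_assoc, ← pow_succ']
    · rw [hn]
      exact Ideal.mul_mono_left hKJ
  exact ⟨s, x, le_antisymm (hJ.le_of_le hred hKJ) hKJ, hind⟩

theorem Multiset.prod_map_sub_prod_map_mem {R σ : Type*} [CommRing R] {J K : Ideal R} {u v : σ → R}
    (hu : ∀ i, u i ∈ J) (hv : ∀ i, v i ∈ J) (huv : ∀ i, u i - v i ∈ K) (l : Multiset σ) :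
    (l.map u).prod - (l.map v).prod ∈ K * J ^ (l.card - 1) := by
  induction l using Multiset.induction with
  | empty => simp
  | cons i l ih =>
    have hP : (l.map u).prod ∈ J ^ l.card := by
      clear ih
      induction l using Multiset.induction with
      | empty => simp
      | cons i l ih =>
        rw [Multiset.map_cons, Multiset.prod_cons, Multiset.card_cons, pow_succ']
        exact Ideal.mul_mem_mul (hu i) ih
    rw [Multiset.map_cons, Multiset.prod_cons, Multiset.map_cons, Multiset.prod_cons,
      Multiset.card_cons, Nat.add_sub_cancel]
    have : u i * (l.map u).prod - v i * (l.map v).prod =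
        (u i - v i) * (l.map u).prod + v i * ((l.map u).prod - (l.map v).prod) := by ring
    rw [this]
    refine Ideal.add_mem _ (Ideal.mul_mem_mul (huv i) hP) ?_
    rcases Nat.eq_zero_or_pos l.card with h0 | h0
    · rw [Multiset.card_eq_zero.1 h0]
      simp
    · obtain ⟨c, hc⟩ := Nat.exists_eq_add_of_lt h0
      have hc : l.card = c + 1 := by omega
      rw [hc, Nat.add_sub_cancel] at ih
      rw [hc, pow_succ', mul_left_comm]
      exact Ideal.mul_mem_mul (hv i) ih

theorem MvPolynomial.eval_sub_eval_mem {R σ : Type*} [CommRing R] {J K : Ideal R} {u v : σ → R}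
    (hu : ∀ i, u i ∈ J) (hv : ∀ i, v i ∈ J) (huv : ∀ i, u i - v i ∈ K) {n : ℕ}
    {f : MvPolynomial σ R} (hf : f.IsHomogeneous n) : eval u f - eval v f ∈ K * J ^ (n - 1) := by
  rw [eval_eq, eval_eq, ← Finset.sum_sub_distrib]
  refine Ideal.sum_mem _ fun m hm => ?_
  rw [← mul_sub]
  refine Ideal.mul_mem_left _ _ ?_
  have h := Multiset.prod_map_sub_prod_map_mem hu hv huv (Finsupp.toMultiset m)
  have hprod : ∀ w : σ → R, ((Finsupp.toMultiset m).map w).prod = ∏ i ∈ m.support, w i ^ m i :=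
    fun w => by rw [Finsupp.toMultiset_map, Finsupp.prod_toMultiset, Finsupp.prod_mapDomain_index
      (by simp) (by intros; rw [pow_add]), Finsupp.prod]
  have hcard : (Finsupp.toMultiset m).card = n := by
    rw [Finsupp.card_toMultiset, Finsupp.sum]
    exact (hf.degree_eq_sum_deg_support hm).symm
  rwa [hprod, hprod, hcard] at h

theorem Ideal.sup_span_singleton_pow_le {R : Type*} [CommRing R] (K : Ideal R) (y : R) (n : ℕ) :
    (K ⊔ Ideal.span {y}) ^ (n + 1) ≤ K * (K ⊔ Ideal.span {y}) ^ n ⊔ Ideal.span {y ^ (n + 1)} := by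
  induction n with
  | zero => simp
  | succ n ih =>
    rw [pow_succ' _ (n + 1)]
    refine (Ideal.mul_mono_right ih).trans ?_
    rw [Ideal.mul_sup]
    refine sup_le ?_ ?_
    · rw [mul_left_comm, ← pow_succ']
      exact le_sup_left
    · rw [Ideal.sup_mul, Ideal.span_singleton_mul_span_singleton, ← pow_succ']
      refine sup_le (le_sup_of_le_left (Ideal.mul_mono_right ?_)) le_sup_right
      rw [Ideal.span_singleton_le_iff_mem]
      exact Ideal.pow_mem_pow (Ideal.mem_sup_right (Ideal.mem_span_singleton_self y)) _

theorem IsReduction.trans {R : Type*} [CommRing R] {I J K : Ideal R} (hK : IsReduction K J)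
    (hJ : IsReduction J I) : IsReduction K I := by
  obtain ⟨hKJ, m, hm⟩ := hK
  obtain ⟨hJI, n, hn⟩ := hJ
  have hpow : ∀ k, I ^ (k + n) = J ^ k * I ^ n := by
    intro k
    induction k with
    | zero => simp
    | succ k ih =>
      rw [show k + 1 + n = n + 1 + k by ring, pow_add, hn, mul_assoc, ← pow_add, add_comm n k, ih,
        pow_succ', mul_assoc]
  refine ⟨hKJ.trans hJI, m + n, ?_⟩
  rw [show m + n + 1 = m + 1 + n by ring, hpow, hpow, hm, mul_assoc]

/-- A nonzero form over an infinite field has a point where it does not vanish; lift such a point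
from the residue field. -/
theorem MvPolynomial.exists_isUnit_eval [Infinite (ResidueField R)] {s n : ℕ}
    {f : MvPolynomial (Fin s) R} (hf : f.IsHomogeneous n) (hfu : ∃ m, coeff m f ∉ maximalIdeal R) :
    ∃ α : Fin s → R, IsUnit (eval α f) := by
  have h0 : map (residue R) f ≠ 0 := by
    obtain ⟨m, hm⟩ := hfu
    intro h
    apply hm
    rw [← residue_eq_zero_iff, ← coeff_map, h, coeff_zero]
  obtain ⟨a, ha⟩ : ∃ a, eval a (map (residue R) f) ≠ 0 := by
    by_contra! hall
    exact h0 ((hf.map _).eq_zero_of_forall_eval_eq_zero hall)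
  obtain ⟨α, rfl⟩ := (residue_surjective (R := R)).comp_left a
  refine ⟨α, ?_⟩
  rwa [← residue_ne_zero_iff_isUnit, map_eval]

/-- The generators of a minimal reduction are analytically independent. -/
theorem IsMinimalReduction.coeff_mem_of_eval_mem [IsNoetherianRing R] [Infinite (ResidueField R)]
    {s : ℕ} {x : Fin s → R} {I : Ideal R}
    (hJ : IsMinimalReduction (Ideal.span (Set.range x)) I)
    (hind : ∀ a : Fin s → R, ∑ i, a i * x i ∈ maximalIdeal R * I → ∀ i, a i ∈ maximalIdeal R)
    {n : ℕ} {f : MvPolynomial (Fin s) R} (hf : f.IsHomogeneous n)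
    (he : eval x f ∈ maximalIdeal R * Ideal.span (Set.range x) ^ n) (m : Fin s →₀ ℕ) :
    coeff m f ∈ maximalIdeal R := by
  by_contra hm
  obtain ⟨α, hα⟩ := exists_isUnit_eval hf ⟨m, hm⟩
  obtain _ | n := n
  · have : f = C (coeff 0 f) := by
      rw [← homogeneousComponent_zero, homogeneousComponent_eq_self hf]
    rw [this, eval_C] at he hα
    rw [pow_zero, mul_one] at he
    exact (mem_nonunits_iff.1 ((mem_maximalIdeal _).1 he)) hα
  obtain ⟨j, hj⟩ : ∃ j, IsUnit (α j) := by
    by_contra! hno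
    have h1 := eval_mem_span_range_pow (x := α) hf
    have h2 : Ideal.span (Set.range α) ^ (n + 1) ≤ maximalIdeal R :=
      (Ideal.pow_le_self n.succ_ne_zero).trans (Ideal.span_le.2 (by
        rintro _ ⟨i, rfl⟩
        exact (mem_maximalIdeal _).2 (hno i)))
    exact (mem_nonunits_iff.1 ((mem_maximalIdeal _).1 (h2 h1))) hα
  set J := Ideal.span (Set.range x) with hJdef
  have hxJ : ∀ i, x i ∈ J := fun i => Ideal.subset_span ⟨i, rfl⟩
  -- K omits one generator of J after a linear change of coordinates. Modulo K the vector α_j x is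
  -- x_j α, so f(x) becomes, up to a unit, x_j^(n+1).
  let K : Ideal R := Ideal.span (Set.range fun i => α j * x i - α i * x j)
  have hKJ : K ≤ J := Ideal.span_le.2 (by
    rintro _ ⟨i, rfl⟩
    exact Ideal.sub_mem _ (Ideal.mul_mem_left _ _ (hxJ i)) (Ideal.mul_mem_left _ _ (hxJ j)))
  have hsup : J = K ⊔ Ideal.span {x j} := by
    refine le_antisymm (Ideal.span_le.2 ?_)
      (sup_le hKJ ((Ideal.span_singleton_le_iff_mem _).2 (hxJ j)))
    rintro _ ⟨i, rfl⟩
    rw [SetLike.mem_coe, ← Ideal.unit_mul_mem_iff_mem _ hj]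
    have : α j * x i = (α j * x i - α i * x j) + α i * x j := by ring
    rw [this]
    exact Ideal.add_mem _ (Ideal.mem_sup_left (Ideal.subset_span ⟨i, rfl⟩))
      (Ideal.mem_sup_right (Ideal.mul_mem_left _ _ (Ideal.mem_span_singleton_self _)))
  have hscale : ∀ (c : R) (v : Fin s → R), eval (fun i => v i * c) f = c ^ (n + 1) * eval v f := by
    intro c v
    rw [eval_eq, eval_eq, Finset.mul_sum]
    refine Finset.sum_congr rfl fun m hm => ?_
    have hdeg := hf.degree_eq_sum_deg_support hm
    simp_rw [mul_pow, Finset.prod_mul_distrib, Finset.prod_pow_eq_pow_sum, ← hdeg]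
    ring
  have hdiff := eval_sub_eval_mem (J := J) (K := K) (u := fun i => x i * α j)
    (v := fun i => α i * x j) (fun i => Ideal.mul_mem_right _ _ (hxJ i))
    (fun i => Ideal.mul_mem_left _ _ (hxJ j))
    (fun i => Ideal.subset_span ⟨i, by dsimp only; ring⟩) hf
  rw [hscale, hscale, Nat.add_sub_cancel] at hdiff
  have hpow : x j ^ (n + 1) ∈ K * J ^ n ⊔ maximalIdeal R * J ^ (n + 1) := by
    rw [← Ideal.unit_mul_mem_iff_mem _ hα, mul_comm (eval α f)]
    have := Ideal.sub_mem _ (Ideal.mem_sup_right (S := K * J ^ n)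
      (Ideal.mul_mem_left _ (α j ^ (n + 1)) he)) (Ideal.mem_sup_left hdiff)
    rwa [sub_sub_cancel] at this
  have hKred : IsReduction K J := by
    refine ⟨hKJ, n, le_antisymm ?_ ?_⟩
    · refine Submodule.le_of_le_smul_of_le_jacobson_bot (I := maximalIdeal R)
        (IsNoetherian.noetherian _) (IsLocalRing.jacobson_eq_maximalIdeal ⊥ bot_ne_top).ge ?_
      have h1 := Ideal.sup_span_singleton_pow_le K (x j) n
      rw [← hsup] at h1
      refine h1.trans (sup_le le_sup_left ?_)
      rwa [Ideal.span_singleton_le_iff_mem]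
    · rw [pow_succ']
      exact Ideal.mul_mono_left hKJ
  have hxK : x j ∈ K := hJ.le_of_le (hKred.trans hJ.prop) hKJ (hxJ j)
  obtain ⟨c, hc⟩ := Ideal.mem_span_range_iff_exists_fun.1 hxK
  classical
  -- Expressing x_j through the generators of K is a linear relation among the x_i. Independence
  -- puts c_i in 𝔪 for i ≠ j, and the coefficient of x_j, in which c_j α_j cancels, then gives -1 in
  -- 𝔪.
  have hzero : ∑ i, (c i * α j - (if i = j then 1 + ∑ k, c k * α k else 0)) * x i = 0 := by
    simp_rw [sub_mul, Finset.sum_sub_distrib, ite_mul, zero_mul]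
    rw [Finset.sum_ite_eq' Finset.univ j, if_pos (Finset.mem_univ j)]
    have : ∑ i, c i * α j * x i - (∑ k, c k * α k) * x j = x j := by
      rw [Finset.sum_mul, ← Finset.sum_sub_distrib]
      exact Eq.trans (Finset.sum_congr rfl fun i _ => by ring) hc
    linear_combination this
  have hmem := hind _ (hzero ▸ Ideal.zero_mem _)
  have hcm : ∀ i, i ≠ j → c i ∈ maximalIdeal R := by
    intro i hij
    have := hmem i
    rw [if_neg hij, sub_zero] at this
    exact (Ideal.mul_unit_mem_iff_mem _ hj).1 this
  have hjm := hmem j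
  rw [if_pos rfl, ← Finset.add_sum_erase _ _ (Finset.mem_univ j)] at hjm
  have hrest : ∑ k ∈ Finset.univ.erase j, c k * α k ∈ maximalIdeal R :=
    Ideal.sum_mem _ fun k hk => Ideal.mul_mem_right _ _ (hcm k (Finset.ne_of_mem_erase hk))
  have h1 := Ideal.add_mem _ hjm hrest
  have h2 : (-1 : R) ∈ maximalIdeal R := by
    convert h1 using 1
    ring
  exact (Ideal.ne_top_iff_one _).1 (maximalIdeal.isMaximal R).ne_top (by simpa using neg_mem h2)

end Reductions

/-! ### Length estimates for powers of an ideal -/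

section AnalyticSpread

open MvPolynomial

variable {R : Type u} [CommRing R]

/-- B/A is generated by the class of b, which C annihilates, so B/A is contained in an image of R/C.
-/
theorem Ideal.length_quotient_le_add {A B C : Ideal R} (b : R) (hAB : A ≤ B)
    (hB : B ≤ A ⊔ Ideal.span {b}) (hC : Ideal.span {b} * C ≤ A) :
    Module.length R (R ⧸ A) ≤ Module.length R (R ⧸ C) + Module.length R (R ⧸ B) := by
  let g : (R ⧸ A) →ₗ[R] (R ⧸ B) := Submodule.factor hAB
  let f : (R ⧸ C) →ₗ[R] (R ⧸ A) := Submodule.mapQ C A (LinearMap.mulLeft R b) (fun c hc => by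
    exact hC (Ideal.mul_mem_mul (Ideal.mem_span_singleton_self b) hc))
  have hg : Function.Surjective g := Submodule.factor_surjective hAB
  have hle : LinearMap.ker g ≤ LinearMap.range f := by
    intro r hr
    obtain ⟨r, rfl⟩ := Submodule.mkQ_surjective _ r
    have hr : r ∈ B := by
      rw [LinearMap.mem_ker] at hr
      exact (Submodule.Quotient.mk_eq_zero B).1 hr
    obtain ⟨a, ha, c, hc, rfl⟩ := Submodule.mem_sup.1 (hB hr)
    obtain ⟨c, rfl⟩ := Ideal.mem_span_singleton'.1 hc
    refine ⟨Submodule.Quotient.mk c, ?_⟩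
    refine (Submodule.Quotient.eq A).2 ?_
    change b * c - (a + c * b) ∈ A
    have : b * c - (a + c * b) = -a := by ring
    rw [this]
    exact neg_mem ha
  rw [Module.length_eq_add_of_exact (LinearMap.ker g).subtype g (Submodule.subtype_injective _) hg
    (LinearMap.exact_subtype_ker_map g)]
  gcongr
  exact (Module.length_le_of_injective (Submodule.inclusion hle)
    (Submodule.inclusion_injective hle)).trans
    (Module.length_le_of_surjective f.rangeRestrict f.surjective_rangeRestrict)

theorem Ideal.length_quotient_le_of_le {A B : Ideal R} (hAB : A ≤ B) :
    Module.length R (R ⧸ B) ≤ Module.length R (R ⧸ A) :=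
  Module.length_le_of_surjective (Submodule.factor hAB) (Submodule.factor_surjective hAB)

theorem Ideal.length_quotient_add_one_le {A B : Ideal R} (hAB : A < B) :
    Module.length R (R ⧸ B) + 1 ≤ Module.length R (R ⧸ A) := by
  let g : (R ⧸ A) →ₗ[R] (R ⧸ B) := Submodule.factor hAB.le
  rw [Module.length_eq_add_of_exact (LinearMap.ker g).subtype g (Submodule.subtype_injective _)
    (Submodule.factor_surjective hAB.le) (LinearMap.exact_subtype_ker_map g), add_comm]
  gcongr
  rw [Order.one_le_iff_ne_zero, ne_eq, Module.length_eq_zero_iff, not_subsingleton_iff_nontrivial,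
    Submodule.nontrivial_iff_ne_bot]
  intro hbot
  obtain ⟨b, hb, hbA⟩ := Set.exists_of_ssubset hAB
  have : (Submodule.Quotient.mk b : R ⧸ A) ∈ LinearMap.ker g :=
    LinearMap.mem_ker.2 ((Submodule.Quotient.mk_eq_zero B).2 hb)
  rw [hbot, Submodule.mem_bot, Submodule.Quotient.mk_eq_zero] at this
  exact hbA this

theorem Ideal.length_quotient_sup_span_pow_le (𝔠 : Ideal R) (t : R) (N : ℕ) :
    Module.length R (R ⧸ (𝔠 ⊔ Ideal.span {t ^ N})) ≤
      N * Module.length R (R ⧸ (𝔠 ⊔ Ideal.span {t})) := by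
  induction N with
  | zero =>
    have : Subsingleton (R ⧸ (𝔠 ⊔ Ideal.span {t ^ 0})) := by
      rw [Ideal.Quotient.subsingleton_iff]
      simp
    simp [Module.length_eq_zero]
  | succ N ih =>
    refine (Ideal.length_quotient_le_add (B := 𝔠 ⊔ Ideal.span {t ^ N}) (C := 𝔠 ⊔ Ideal.span {t})
      (t ^ N) ?_ ?_ ?_).trans ?_
    · refine sup_le_sup_left ?_ _
      rw [Ideal.span_singleton_le_span_singleton]
      exact pow_dvd_pow t N.le_succ
    · exact sup_le (le_sup_of_le_left le_sup_left) le_sup_right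
    · rw [Ideal.mul_sup, Ideal.span_singleton_mul_span_singleton, ← pow_succ]
      exact sup_le_sup_right Ideal.mul_le_right _
    · push_cast
      rw [add_mul, one_mul, add_comm]
      gcongr

theorem Ideal.length_quotient_span_pow_le (T : Finset R) (N : ℕ) (𝔠 : Ideal R) :
    Module.length R (R ⧸ (𝔠 ⊔ Ideal.span ((fun t => t ^ N) '' (T : Set R)))) ≤
      N ^ T.card * Module.length R (R ⧸ (𝔠 ⊔ Ideal.span (T : Set R))) := by
  classical
  induction T using Finset.induction generalizing 𝔠 with
  | empty =>
    rw [Finset.coe_empty, Set.image_empty, Ideal.span_empty, sup_bot_eq]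
    simp
  | insert t T ht ih =>
    rw [Finset.coe_insert, Set.image_insert_eq, Ideal.span_insert, Ideal.span_insert, ← sup_assoc,
      Finset.card_insert_of_notMem ht, pow_succ, mul_assoc]
    refine (ih _).trans ?_
    gcongr
    rw [sup_right_comm, sup_comm (Ideal.span {t}), ← sup_assoc]
    exact Ideal.length_quotient_sup_span_pow_le _ _ _

variable [IsLocalRing R]

/-- The forms vanishing modulo `𝔪 J ^ n` at the generators `x` of `J` have coefficients in `𝔪`. -/
def AnalyticallyIndependent {s : ℕ} (x : Fin s → R) : Prop :=
  ∀ (n : ℕ) (f : MvPolynomial (Fin s) R), f.IsHomogeneous n →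
    eval x f ∈ maximalIdeal R * Ideal.span (Set.range x) ^ n → ∀ m, coeff m f ∈ maximalIdeal R

/-- Monomials of degree n are independent in J^n/𝔪J^n, so adjoining them to 𝔪J^n one at a time gives
a strict chain. Induction on n covers the lower degrees. -/
theorem AnalyticallyIndependent.card_le_length {s : ℕ} {x : Fin s → R}
    (h : AnalyticallyIndependent x) (hxm : Ideal.span (Set.range x) ≤ maximalIdeal R) (n : ℕ)
    (T : Finset (Fin s →₀ ℕ)) (hT : ∀ α ∈ T, α.degree < n) :
    (T.card : ℕ∞) ≤ Module.length R (R ⧸ Ideal.span (Set.range x) ^ n) := by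
  classical
  set J := Ideal.span (Set.range x) with hJ
  induction n generalizing T with
  | zero =>
    have : T = ∅ := Finset.eq_empty_of_forall_notMem fun α hα => absurd (hT α hα) (by omega)
    simp [this]
  | succ n ih =>
    let mon : (Fin s →₀ ℕ) → R := fun α => eval x (monomial α 1)
    have hmon : ∀ α, mon α ∈ J ^ α.degree := fun α =>
      eval_mem_span_range_pow (isHomogeneous_monomial 1 rfl)
    have step : ∀ T' : Finset (Fin s →₀ ℕ), (∀ α ∈ T', α.degree = n) →
        Module.length R (R ⧸ (maximalIdeal R * J ^ n ⊔ Ideal.span (mon '' (T' : Set _)))) + T'.card ≤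
          Module.length R (R ⧸ (maximalIdeal R * J ^ n)) := by
      intro T' hT'
      induction T' using Finset.induction with
      | empty =>
        rw [Finset.coe_empty, Set.image_empty, Ideal.span_empty, sup_bot_eq]
        simp
      | insert α T' hα ih' =>
        refine le_trans ?_ (ih' fun β hβ => hT' β (Finset.mem_insert_of_mem hβ))
        rw [Finset.card_insert_of_notMem hα, Nat.cast_add, Nat.cast_one, add_comm (T'.card : ℕ∞),
          ← add_assoc]
        gcongr
        refine Ideal.length_quotient_add_one_le (lt_of_le_of_ne ?_ ?_)
        · refine sup_le_sup_left (Ideal.span_mono (Set.image_mono ?_)) _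
          simp
        · intro heq
          have hmem : mon α ∈ maximalIdeal R * J ^ n ⊔ Ideal.span (mon '' (T' : Set _)) := by
            rw [heq]
            exact Ideal.mem_sup_right (Ideal.subset_span ⟨α, by simp, rfl⟩)
          obtain ⟨a, ha, b, hb, hab⟩ := Submodule.mem_sup.1 hmem
          obtain ⟨c, hc⟩ := (Submodule.mem_span_image_finset_iff_exists_fun R).1 hb
          have := h n (monomial α 1 - ∑ β : T', C (c β) * monomial (β : Fin s →₀ ℕ) 1) (by
              refine (isHomogeneous_monomial 1 (hT' α (by simp))).sub
                (IsHomogeneous.sum _ _ _ fun β hβ => IsHomogeneous.C_mul ?_ _)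
              exact isHomogeneous_monomial 1 (hT' β (by simp [β.2])))
            (by
              have : eval x (monomial α 1 - ∑ β : T', C (c β) * monomial (β : Fin s →₀ ℕ) 1) = a := by
                rw [map_sub, map_sum]
                simp_rw [map_mul, eval_C]
                change mon α - ∑ β : T', c β * mon β = a
                simp_rw [smul_eq_mul] at hc
                rw [hc, ← hab, add_sub_cancel_right]
              rwa [this]) α
          rw [coeff_sub, coeff_sum, coeff_monomial, if_pos rfl, Finset.sum_eq_zero, sub_zero] at this
          · exact (Ideal.ne_top_iff_one _).1 (maximalIdeal.isMaximal R).ne_top this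
          · intro β hβ
            rw [coeff_C_mul, coeff_monomial, if_neg (by rintro rfl; exact hα β.2), mul_zero]
    have hsplit : T.card = (T.filter fun α => α.degree < n).card +
        (T.filter fun α => α.degree = n).card := by
      rw [← Finset.card_filter_add_card_filter_not (s := T) (p := fun α => α.degree < n)]
      congr 2
      refine Finset.filter_congr fun α hα => ?_
      have := hT α hα
      omega
    have h1 := ih (T.filter fun α => α.degree < n) (by simp)
    have h2 := step (T.filter fun α => α.degree = n) (by simp)
    rw [hsplit, Nat.cast_add]
    calc _ ≤ Module.length R (R ⧸ (maximalIdeal R * J ^ n ⊔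
          Ideal.span (mon '' ((T.filter fun α => α.degree = n : Finset _) : Set _)))) +
          ((T.filter fun α => α.degree = n).card : ℕ∞) := by
            gcongr
            refine h1.trans (Ideal.length_quotient_le_of_le (sup_le Ideal.mul_le_right ?_))
            rw [Ideal.span_le]
            rintro _ ⟨α, hα, rfl⟩
            have := hmon α
            rwa [(Finset.mem_filter.1 hα).2] at this
      _ ≤ _ := h2
      _ ≤ _ := by
            refine Ideal.length_quotient_le_of_le ?_
            rw [pow_succ']
            exact Ideal.mul_mono_left hxm

end AnalyticSpread

/-! ### Minimal reductions generated by a system of parameters -/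

section ParameterIdeal

open MvPolynomial RingTheory.Sequence

variable {R : Type u} [CommRing R] [IsLocalRing R] [IsNoetherianRing R]

theorem IsLocalRing.exists_pow_le_of_radical_eq {I : Ideal R} (hI : I.radical = maximalIdeal R) :
    ∃ n, maximalIdeal R ^ n ≤ I := by
  obtain ⟨n, hn⟩ := I.exists_radical_pow_le_of_fg (hI ▸ IsNoetherian.noetherian _)
  exact ⟨n, hI ▸ hn⟩

/-- The number of analytically independent generators of an `𝔪`-primary ideal is at most the
dimension. -/
theorem AnalyticallyIndependent.le_of_ringKrullDim_eq {s d : ℕ} {x : Fin s → R}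
    (h : AnalyticallyIndependent x) (hx : (Ideal.span (Set.range x)).radical = maximalIdeal R)
    (hdim : ringKrullDim R = (d : WithBot ℕ∞)) : s ≤ d := by
  classical
  set J := Ideal.span (Set.range x) with hJ
  have hxm : J ≤ maximalIdeal R := hx ▸ Ideal.le_radical
  obtain ⟨e, he⟩ := exists_pow_le_of_radical_eq hx
  obtain ⟨T, hTmin, hTcard⟩ := Ideal.exists_finset_card_eq_height_of_isNoetherianRing (maximalIdeal R)
  have hTd : T.card = d := by
    have h1 := IsLocalRing.maximalIdeal_height_eq_ringKrullDim (R := R)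
    rw [hdim, ← hTcard] at h1
    exact_mod_cast h1
  have hart : IsArtinianRing (R ⧸ Ideal.span (T : Set R)) :=
    IsLocalRing.quotient_artinian_of_mem_minimalPrimes_of_isLocalRing _ hTmin
  have hlen : Module.length R (R ⧸ Ideal.span (T : Set R)) ≠ ⊤ := by
    rw [Module.length_eq_of_surjective (R := R ⧸ Ideal.span (T : Set R)) (S := R)
      Ideal.Quotient.mk_surjective]
    exact Module.length_ne_top
  obtain ⟨Λ, hΛ⟩ := ENat.ne_top_iff_exists.1 hlen
  have hTm : ∀ t ∈ T, t ∈ maximalIdeal R := fun t ht => hTmin.1.2 (Ideal.subset_span ht)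
  -- With T a system of parameters and 𝔪^e ≤ J, all t^(eN) lie in J^N, so the length grows at most
  -- like N^d.
  have hupper : ∀ N, Module.length R (R ⧸ J ^ N) ≤ ((e * N) ^ d * Λ : ℕ) := by
    intro N
    have h1 := Ideal.length_quotient_span_pow_le T (e * N) ⊥
    rw [bot_sup_eq, bot_sup_eq, hTd, ← hΛ] at h1
    refine (Ideal.length_quotient_le_of_le ?_).trans (by exact_mod_cast h1)
    rw [Ideal.span_le]
    rintro _ ⟨t, ht, rfl⟩
    dsimp only
    rw [SetLike.mem_coe, pow_mul]
    exact Ideal.pow_mem_pow (he (Ideal.pow_mem_pow (hTm t ht) e)) N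
  -- The l^s monomials with all exponents below l have degree at most s l, so the length grows at
  -- least like the s-th power.
  have hlower : ∀ l, l ^ s ≤ (e * (s * l + 1)) ^ d * Λ := by
    intro l
    let T' : Finset (Fin s →₀ ℕ) := (Fintype.piFinset fun _ : Fin s => Finset.range l).map
      Finsupp.equivFunOnFinite.symm.toEmbedding
    have hcard : T'.card = l ^ s := by simp [T']
    have hdeg : ∀ α ∈ T', α.degree < s * l + 1 := by
      intro α hα
      simp only [T', Finset.mem_map, Fintype.mem_piFinset, Finset.mem_range] at hα
      obtain ⟨a, ha, rfl⟩ := hα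
      rw [Finsupp.degree_eq_sum]
      have : ∑ i : Fin s, a i ≤ ∑ _i : Fin s, l := Finset.sum_le_sum fun i _ => (ha i).le
      simp at this
      simpa using Nat.lt_succ_of_le this
    have := (h.card_le_length hxm _ T' hdeg).trans (hupper (s * l + 1))
    rw [hcard] at this
    exact_mod_cast this
  by_contra! hsd
  obtain ⟨c, rfl⟩ := Nat.exists_eq_add_of_lt hsd
  set s := d + c + 1
  -- The upper bound at l is at most C l^d. With s > d, the choice l = C + 1 makes l^s ≥ l^d (C + 1)
  -- exceed it.
  let C := (e * (s + 1)) ^ d * Λ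
  have h1 := hlower (C + 1)
  have h2 : (C + 1) ^ d * (C + 1) ≤ (C + 1) ^ s := by
    rw [← pow_succ]
    exact Nat.pow_le_pow_right C.succ_pos (by omega)
  have h3 : (e * (s * (C + 1) + 1)) ^ d * Λ ≤ (C + 1) ^ d * C := by
    calc (e * (s * (C + 1) + 1)) ^ d * Λ ≤ (e * (s + 1) * (C + 1)) ^ d * Λ := by
          refine Nat.mul_le_mul_right _ (Nat.pow_le_pow_left ?_ _)
          rw [mul_assoc]
          exact Nat.mul_le_mul_left _ (by nlinarith)
      _ = (C + 1) ^ d * C := by rw [mul_pow]; ring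
  have h4 := (h2.trans h1).trans h3
  exact absurd (Nat.le_of_mul_le_mul_left h4 (by positivity)) (by omega)

/-- Krull's height theorem applied to the maximal ideal, which is minimal over (x). -/
theorem IsLocalRing.le_of_radical_span_range_eq {s d : ℕ} {x : Fin s → R}
    (hx : (Ideal.span (Set.range x)).radical = maximalIdeal R)
    (hdim : ringKrullDim R = (d : WithBot ℕ∞)) : d ≤ s := by
  classical
  have hmin : maximalIdeal R ∈ (Ideal.span (Set.range x)).minimalPrimes := by
    refine ⟨⟨inferInstance, hx ▸ Ideal.le_radical⟩, fun Q hQ _ => ?_⟩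
    rw [← hx]
    exact hQ.1.radical_le_iff.2 hQ.2
  have h1 := Ideal.height_le_card_of_mem_minimalPrimes_span (Set.finite_range x) hmin
  have h2 := IsLocalRing.maximalIdeal_height_eq_ringKrullDim (R := R)
  rw [hdim] at h2
  have h3 : (maximalIdeal R).height = d := by exact_mod_cast h2
  rw [h3] at h1
  have h4 : d ≤ (Set.range x).ncard := by exact_mod_cast h1
  refine h4.trans ?_
  rw [← Set.image_univ]
  refine (Set.ncard_image_le Set.finite_univ).trans ?_
  simp

theorem quasiRegular_of_isWeaklyRegular {R : Type*} [CommRing R] {d : ℕ} {x : Fin d → R}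
    (h : IsWeaklyRegular R (List.ofFn x)) : QuasiRegular x := by
  refine quasiRegular_of_forall_fin fun i r hr => ?_
  have hreg := h.regular_mod_prev i (by simp)
  have hset : Ideal.ofList ((List.ofFn x).take i) • (⊤ : Submodule R R) =
      Ideal.span (x '' {j | j < i}) := by
    rw [smul_eq_mul, Ideal.mul_top]
    refine congrArg Ideal.span (Set.ext fun y => ?_)
    change y ∈ (List.ofFn x).take i ↔ _
    rw [List.mem_take_iff_getElem]
    simp only [List.length_ofFn, List.getElem_ofFn, Set.mem_image, Set.mem_ofPred_eq]
    constructor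
    · rintro ⟨j, hj, rfl⟩
      exact ⟨⟨j, by omega⟩, Fin.lt_def.2 (by simp; omega), rfl⟩
    · rintro ⟨j, hj, rfl⟩
      exact ⟨j, by have := Fin.lt_def.1 hj; omega, rfl⟩
  rw [hset, List.getElem_ofFn] at hreg
  exact mem_of_isSMulRegular_quotient_of_smul_mem hreg hr

/-- In a Cohen-Macaulay local ring, `d = dim R` generators of an `𝔪`-primary ideal form a
quasi-regular family. -/
theorem IsCohenMacaulayLocalRing.quasiRegular {R : Type u} [CommRing R] [IsLocalRing R]
    (hR : IsCohenMacaulayLocalRing R) {d : ℕ} (hdim : ringKrullDim R = (d : WithBot ℕ∞))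
    {x : Fin d → R} (hx : (Ideal.span (Set.range x)).radical = maximalIdeal R) :
    QuasiRegular x := by
  have := hR.isNoetherianRing
  have hxm : Ideal.span (Set.range x) ≤ maximalIdeal R := hx ▸ Ideal.le_radical
  refine quasiRegular_of_isWeaklyRegular (isWeaklyRegular_of_hasDepthGE_length _
    (by simpa using hR.hasDepthGE hdim) ?_ ?_)
  · intro r hr
    obtain ⟨i, rfl⟩ := (List.mem_ofFn' x r).1 hr
    exact hxm (Ideal.subset_span ⟨i, rfl⟩)
  · intro P hP _ hPx
    refine le_antisymm (le_maximalIdeal hP.ne_top) ?_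
    rw [← hx, hP.radical_le_iff, Ideal.span_le]
    rintro _ ⟨i, rfl⟩
    exact hPx _ ((List.mem_ofFn' x _).2 ⟨i, rfl⟩)

theorem IsReduction.radical_eq {R : Type*} [CommRing R] {I J : Ideal R} (h : IsReduction J I) :
    J.radical = I.radical := by
  obtain ⟨hle, n, hn⟩ := h
  refine le_antisymm (Ideal.radical_mono hle) ?_
  rw [← Ideal.radical_pow I n.succ_ne_zero, hn]
  exact Ideal.radical_mono Ideal.mul_le_left

/-- A minimal reduction of an `𝔪`-primary ideal of a Cohen-Macaulay local ring of dimension `d` is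
generated by a quasi-regular family of `d` elements that are independent modulo `𝔪 I`. -/
theorem IsMinimalReduction.exists_quasiRegular {R : Type u} [CommRing R] [IsLocalRing R]
    (hR : IsCohenMacaulayLocalRing R) [Infinite (ResidueField R)] {d : ℕ}
    (hdim : ringKrullDim R = (d : WithBot ℕ∞)) {I J : Ideal R} (hI : I.radical = maximalIdeal R)
    (hJ : IsMinimalReduction J I) : ∃ x : Fin d → R, J = Ideal.span (Set.range x) ∧
      QuasiRegular x ∧
      ∀ a : Fin d → R, ∑ i, a i * x i ∈ maximalIdeal R * I → ∀ i, a i ∈ maximalIdeal R := by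
  have := hR.isNoetherianRing
  obtain ⟨s, x, rfl, hind⟩ := hJ.exists_generators
  have hrad : (Ideal.span (Set.range x)).radical = maximalIdeal R := hJ.prop.radical_eq.trans hI
  have hai : AnalyticallyIndependent x := fun n f hf he => hJ.coeff_mem_of_eval_mem hind hf he
  obtain rfl : s = d := le_antisymm (hai.le_of_ringKrullDim_eq hrad hdim)
    (le_of_radical_span_range_eq hrad hdim)
  exact ⟨x, rfl, hR.quasiRegular hdim hrad, hind⟩

end ParameterIdeal

/-! ### Depth of modules with cyclic relation modules over a factorial domain -/

section TorsionFree

variable {S : Type u} [CommRing S] [IsDomain S] [IsNoetherianRing S] {𝔫 : Ideal S} {n : ℕ}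

/-- Over a domain the kernel is zero or free of rank one, so M has projective dimension at most one
and loses at most one from the depth of S. -/
theorem HasDepthGE.of_ker_eq_span_singleton (hS : HasDepthGE 𝔫 S (n + 1)) {G M : Type v}
    [AddCommGroup G] [Module S G] [Module.Free S G] [Module.Finite S G] [AddCommGroup M]
    [Module S M] (π : G →ₗ[S] M) (hπ : Function.Surjective π) (g : G)
    (hg : LinearMap.ker π = Submodule.span S {g}) : HasDepthGE 𝔫 M n := by
  have : Module.Finite S M := Module.Finite.of_surjective π hπ
  have hfin : Module.Finite S (LinearMap.ker π) := by
    rw [Module.Finite.iff_fg]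
    exact IsNoetherian.noetherian _
  have hG : HasDepthGE 𝔫 G (n + 1) := hS.of_finite_free G
  by_cases h0 : g = 0
  · rw [h0, Submodule.span_zero_singleton] at hg
    exact (hG.congr (LinearEquiv.ofBijective π ⟨LinearMap.ker_eq_bot.1 hg, hπ⟩)).pred
  · refine HasDepthGE.of_exact_right (LinearMap.ker π).subtype π (Submodule.subtype_injective _)
      (LinearMap.exact_subtype_ker_map π) hπ ?_ hG
    rw [hg]
    exact hS.congr (LinearEquiv.toSpanNonzeroSingleton S G g h0)

/-- A torsion-free module with two generators over a factorial ring of depth `n + 1` has depth at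
least `n`. -/
theorem HasDepthGE.of_torsionFree_of_span_pair [UniqueFactorizationMonoid S]
    (hS : HasDepthGE 𝔫 S (n + 1)) {C : Type u} [AddCommGroup C] [Module S C]
    (htf : ∀ (p : S) (c : C), p • c = 0 → p = 0 ∨ c = 0) {w₁ w₂ : C}
    (hw : Submodule.span S {w₁, w₂} = ⊤) : HasDepthGE 𝔫 C n := by
  have key : ∀ w : C, Submodule.span S {w} = ⊤ → HasDepthGE 𝔫 C n := by
    intro w hw
    have hsurj : Function.Surjective (LinearMap.toSpanSingleton S C w) := by
      rw [← LinearMap.range_eq_top, LinearMap.range_toSpanSingleton, hw]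
    by_cases h0 : w = 0
    · refine hS.of_ker_eq_span_singleton _ hsurj 1 ?_
      rw [h0, LinearMap.toSpanSingleton_zero, LinearMap.ker_zero, eq_comm, Ideal.submodule_span_eq,
        Ideal.span_singleton_one]
    · refine hS.of_ker_eq_span_singleton _ hsurj 0 ?_
      rw [Submodule.span_zero_singleton, LinearMap.ker_eq_bot']
      intro p hp
      exact (htf p w hp).resolve_right h0
  by_cases h1 : w₁ = 0
  · refine key w₂ ?_
    rw [← hw, h1, Submodule.span_insert_zero]
  let π : S × S →ₗ[S] C :=
    (LinearMap.toSpanSingleton S C w₁).coprod (LinearMap.toSpanSingleton S C w₂)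
  have hπ : ∀ p q : S, π (p, q) = p • w₁ + q • w₂ := fun p q => by simp [π]
  have hsurj : Function.Surjective π := by
    rw [← LinearMap.range_eq_top, LinearMap.range_coprod, LinearMap.range_toSpanSingleton,
      LinearMap.range_toSpanSingleton, ← Submodule.span_insert, hw]
  by_cases hK : LinearMap.ker π = ⊥
  · exact hS.of_ker_eq_span_singleton π hsurj 0 (by rw [Submodule.span_zero_singleton, hK])
  obtain ⟨⟨p, q⟩, hpq, hne⟩ := Submodule.exists_mem_ne_zero_of_ne_bot hK
  rw [LinearMap.mem_ker, hπ] at hpq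
  have hq : q ≠ 0 := by
    rintro rfl
    rw [zero_smul, add_zero] at hpq
    exact hne (by rw [(htf p w₁ hpq).resolve_right h1]; rfl)
  -- Torsion-freeness permits division of the relation by the common factor c. Any other relation is
  -- proportional to the reduced one, and by coprimality it is a multiple of it in S.
  obtain ⟨q₀, p₀, c, hrel, rfl, rfl⟩ := UniqueFactorizationMonoid.exists_reduced_factors q hq p
  have hc : c ≠ 0 := left_ne_zero_of_mul hq
  have hq0 : q₀ ≠ 0 := right_ne_zero_of_mul hq
  have hpq0 : p₀ • w₁ + q₀ • w₂ = 0 :=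
    (htf c _ (by rw [smul_add, smul_smul, smul_smul, hpq])).resolve_left hc
  refine hS.of_ker_eq_span_singleton π hsurj (p₀, q₀) (le_antisymm ?_ ?_)
  · rintro ⟨p', q'⟩ hmem
    rw [LinearMap.mem_ker, hπ] at hmem
    have h2 : (q₀ * p' - q' * p₀) • w₁ = 0 := by
      have : (q₀ * p' - q' * p₀) • w₁ = q₀ • (p' • w₁ + q' • w₂) - q' • (p₀ • w₁ + q₀ • w₂) := by
        module
      rw [this, hmem, hpq0, smul_zero, smul_zero, sub_zero]
    have h3 := sub_eq_zero.1 ((htf _ _ h2).resolve_right h1)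
    obtain ⟨e, rfl⟩ : q₀ ∣ q' := hrel.dvd_of_dvd_mul_right (h3 ▸ dvd_mul_right q₀ p')
    rw [mul_assoc] at h3
    rw [Submodule.mem_span_singleton]
    exact ⟨e, Prod.ext (by simpa using (mul_left_cancel₀ hq0 h3).symm) (by simp [mul_comm])⟩
  · rw [Submodule.span_singleton_le_iff_mem, LinearMap.mem_ker, hπ, hpq0]

/-- Image and cokernel of `Ψ` both have depth at least n: the image because its relations are
cyclic, the cokernel because it is torsion-free on two generators. M is an extension of the two. -/
theorem HasDepthGE.of_range_of_span_pair [UniqueFactorizationMonoid S]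
    (hS : HasDepthGE 𝔫 S (n + 1)) {G M : Type u}
    [AddCommGroup G] [Module S G] [Module.Free S G] [Module.Finite S G] [AddCommGroup M]
    [Module S M] (Ψ : G →ₗ[S] M) (g : G) (hg : LinearMap.ker Ψ = Submodule.span S {g})
    (htf : ∀ (p : S) (c : M), p • c ∈ LinearMap.range Ψ → p = 0 ∨ c ∈ LinearMap.range Ψ) {w₁ w₂ : M}
    (hw : LinearMap.range Ψ ⊔ Submodule.span S {w₁, w₂} = ⊤) : HasDepthGE 𝔫 M n := by
  have hfin : Module.Finite S M := by
    rw [Module.finite_def, ← hw]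
    refine Submodule.FG.sup ?_ (Submodule.fg_span (Set.toFinite _))
    rw [LinearMap.range_eq_map]
    exact (Module.finite_def.1 inferInstance).map Ψ
  have h1 : HasDepthGE 𝔫 (LinearMap.range Ψ) n :=
    hS.of_ker_eq_span_singleton Ψ.rangeRestrict Ψ.surjective_rangeRestrict g
      (by rw [LinearMap.ker_rangeRestrict, hg])
  have h2 : HasDepthGE 𝔫 (M ⧸ LinearMap.range Ψ) n := by
    refine hS.of_torsionFree_of_span_pair (w₁ := (LinearMap.range Ψ).mkQ w₁)
      (w₂ := (LinearMap.range Ψ).mkQ w₂) ?_ ?_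
    · intro p c hc
      obtain ⟨c, rfl⟩ := Submodule.mkQ_surjective _ c
      rw [← map_smul, Submodule.mkQ_apply, Submodule.Quotient.mk_eq_zero] at hc
      refine (htf p c hc).imp_right fun h => ?_
      rwa [Submodule.mkQ_apply, Submodule.Quotient.mk_eq_zero]
    · rw [← Set.image_pair, ← Submodule.map_span, eq_top_iff, ← (LinearMap.range Ψ).range_mkQ,
        ← Submodule.map_top (f := (LinearMap.range Ψ).mkQ), ← hw, Submodule.map_sup]

      refine sup_le ?_ le_rfl
      rw [Submodule.mkQ_map_self]
      exact bot_le
  have : Module.Finite S (LinearMap.range Ψ) := by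
    rw [Module.Finite.iff_fg]
    exact IsNoetherian.noetherian _
  exact HasDepthGE.of_exact_middle (LinearMap.range Ψ).subtype (LinearMap.range Ψ).mkQ
    (Submodule.subtype_injective _) (LinearMap.exact_subtype_mkQ _) (Submodule.mkQ_surjective _) h1 h2

end TorsionFree

theorem MvPolynomial.hasDepthGE_span_range_X (A : Type u) [CommRing A] (d : ℕ) :
    HasDepthGE (Ideal.span (Set.range (X : Fin d → MvPolynomial (Fin d) A)))
      (MvPolynomial (Fin d) A) d := by
  classical
  refine ⟨List.ofFn X, by simp, fun r hr => ?_, ?_⟩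
  · obtain ⟨i, rfl⟩ := (List.mem_ofFn' _ r).1 hr
    exact Ideal.subset_span ⟨i, rfl⟩
  · refine ⟨fun i hi => ?_⟩
    have hi' : i < d := by simpa using hi
    have hset : Ideal.ofList ((List.ofFn (X : Fin d → MvPolynomial (Fin d) A)).take i) •
        (⊤ : Submodule (MvPolynomial (Fin d) A) (MvPolynomial (Fin d) A)) =
        Ideal.span (X '' {j : Fin d | j.val < i}) := by
      rw [smul_eq_mul, Ideal.mul_top]
      refine congrArg Ideal.span (Set.ext fun y => ?_)
      change y ∈ (List.ofFn X).take i ↔ _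
      rw [List.mem_take_iff_getElem]
      simp only [List.length_ofFn, List.getElem_ofFn, Set.mem_image, Set.mem_ofPred_eq]
      constructor
      · rintro ⟨j, hj, rfl⟩
        exact ⟨⟨j, by omega⟩, by simp; omega, rfl⟩
      · rintro ⟨j, hj, rfl⟩
        exact ⟨j, by omega, rfl⟩
    rw [hset, List.getElem_ofFn, isSMulRegular_quotient_iff_mem_of_smul_mem]
    intro f hf
    rw [smul_eq_mul, mem_ideal_span_X_image] at hf
    rw [mem_ideal_span_X_image]
    intro m hm
    obtain ⟨j, hj, hmj⟩ := hf (Finsupp.single ⟨i, hi'⟩ 1 + m) (by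
      rw [mem_support_iff, coeff_X_mul]
      exact mem_support_iff.1 hm)
    refine ⟨j, hj, ?_⟩
    rwa [Finsupp.add_apply, Finsupp.single_eq_of_ne, zero_add] at hmj
    rintro rfl
    exact absurd hj (by simp)

/-! ### Depth of a ring from its structure over a polynomial ring -/

section GenericDepth

variable {S F : Type u} [CommRing S] [CommRing F]

/-- A weakly regular sequence inside a proper ideal is regular, which is where `𝔞 ≠ ⊤` enters. -/
theorem le_idealDepth_of_hasDepthGE [Algebra S F] {𝔫 : Ideal S} {𝔞 : Ideal F} (h𝔞 : 𝔞 ≠ ⊤)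
    (hle : 𝔫 ≤ 𝔞.comap (algebraMap S F)) {n : ℕ} (h : HasDepthGE 𝔫 F n) :
    (n : ℕ∞) ≤ idealDepth 𝔞 F := by
  obtain ⟨rs, rfl, hm, hr⟩ := h
  rw [← RingTheory.Sequence.isWeaklyRegular_map_algebraMap_iff F] at hr
  have hmem : ∀ r ∈ rs.map (algebraMap S F), r ∈ 𝔞 := by
    intro r hr
    obtain ⟨p, hp, rfl⟩ := List.mem_map.1 hr
    exact hle (hm p hp)
  refine le_trans ?_ (le_iSup _ ⟨rs.map (algebraMap S F), hmem, hr, ?_⟩)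
  · simp
  · intro htop
    refine h𝔞 (eq_top_iff.2 ?_)
    rw [htop, smul_eq_mul, Ideal.mul_top]
    exact Ideal.span_le.2 hmem

/-- A depth bound for a ring `F` presented over a factorial ring `S`: modulo the span of `1` and
the `y j`, which satisfy a single relation, `F` is torsion-free with two generators. -/
theorem le_idealDepth_of_presentation [IsDomain S] [IsNoetherianRing S]
    [UniqueFactorizationMonoid S] {𝔫 : Ideal S} {𝔞 : Ideal F} (φ : S →+* F) (h𝔞 : 𝔞 ≠ ⊤)
    (hle : 𝔫 ≤ 𝔞.comap φ) {n : ℕ} (hS : HasDepthGE 𝔫 S (n + 1)) {r : ℕ} (y : Fin r → F)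
    {Ψ : S × (Fin r → S) → F} (hΨ : ∀ p, Ψ p = φ p.1 + ∑ j, φ (p.2 j) * y j)
    (g : S × (Fin r → S)) (hg : Ψ g = 0) (hker : ∀ p, Ψ p = 0 → p ∈ Submodule.span S {g})
    (htf : ∀ p c, (∃ q, φ p * c = Ψ q) → p = 0 ∨ ∃ q, c = Ψ q) {w₁ w₂ : F}
    (hw : ∀ c, ∃ q a b, c = Ψ q + (φ a * w₁ + φ b * w₂)) : (n : ℕ∞) ≤ idealDepth 𝔞 F := by
  let _ := φ.toAlgebra
  have hsmul : ∀ (p : S) (c : F), p • c = φ p * c := fun p c => Algebra.smul_def p c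
  let Ψ' : S × (Fin r → S) →ₗ[S] F :=
    { toFun := Ψ
      map_add' := fun p q => by
        simp only [hΨ, Prod.fst_add, Prod.snd_add, Pi.add_apply, map_add, add_mul,
          Finset.sum_add_distrib]
        ring
      map_smul' := fun c p => by
        simp only [hΨ, Prod.smul_fst, Prod.smul_snd, Pi.smul_apply, smul_eq_mul, map_mul,
          RingHom.id_apply, hsmul, mul_add, Finset.mul_sum, mul_assoc] }
  have hrange : ∀ c, c ∈ LinearMap.range Ψ' ↔ ∃ q, c = Ψ q := fun c => by
    rw [LinearMap.mem_range]
    exact exists_congr fun q => eq_comm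
  refine le_idealDepth_of_hasDepthGE h𝔞 hle (hS.of_range_of_span_pair Ψ' g ?_ ?_ (w₁ := w₁)
    (w₂ := w₂) ?_)
  · refine le_antisymm (fun p hp => hker p hp) ?_
    rw [Submodule.span_singleton_le_iff_mem]
    exact hg
  · intro p c hc
    rw [hrange] at hc ⊢
    exact htf p c (by rwa [hsmul] at hc)
  · rw [eq_top_iff]
    rintro c -
    obtain ⟨q, a, b, rfl⟩ := hw c
    refine Submodule.add_mem_sup ⟨q, rfl⟩ (Submodule.mem_span_pair.2 ⟨a, b, ?_⟩)
    rw [hsmul, hsmul]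

end GenericDepth

/-! ### The fiber cone as an algebra over the polynomial ring -/

section FiberConeMaps

open MvPolynomial

variable {R : Type u} [CommRing R] {I : Ideal R} {d : ℕ} {x : Fin d → R}

theorem Polynomial.coe_mem_fiberConeIdeal_iff [IsLocalRing R] {f : reesAlgebra I} :
    (Ideal.Quotient.mk (fiberConeIdeal I) f) = 0 ↔
      ∀ n, (f : Polynomial R).coeff n ∈ maximalIdeal R * I ^ n :=
  Ideal.Quotient.eq_zero_iff_mem

/-- The element `a t ^ n` of the Rees algebra. -/
noncomputable def reesMonomial (n : ℕ) (a : R) (ha : a ∈ I ^ n) : reesAlgebra I :=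
  ⟨Polynomial.monomial n a, reesAlgebra.monomial_mem.2 ha⟩

@[simp]
theorem coe_reesMonomial (n : ℕ) (a : R) (ha : a ∈ I ^ n) :
    (reesMonomial n a ha : Polynomial R) = Polynomial.monomial n a := rfl

theorem reesAlgebra.sum_reesMonomial (f : reesAlgebra I) :
    f = ∑ n ∈ (f : Polynomial R).support, reesMonomial n ((f : Polynomial R).coeff n) (f.2 n) := by
  refine Subtype.ext ?_
  rw [AddSubmonoidClass.coe_finsetSum]
  exact (f : Polynomial R).as_sum_support

/-- The homomorphism from the polynomial ring to the Rees algebra mapping `X i` to `x i t`. -/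
noncomputable def reesHom (hx : ∀ i, x i ∈ I) : MvPolynomial (Fin d) R →ₐ[R] reesAlgebra I :=
  aeval fun i => reesMonomial 1 (x i) (by rw [pow_one]; exact hx i)

theorem coe_reesHom_monomial (hx : ∀ i, x i ∈ I) (m : Fin d →₀ ℕ) (a : R) :
    (reesHom hx (monomial m a) : Polynomial R) =
      Polynomial.monomial m.degree (eval x (monomial m a)) := by
  rw [reesHom, aeval_monomial, eval_monomial, MulMemClass.coe_mul, Finsupp.prod, Finsupp.prod,
    SubmonoidClass.coe_finsetProd]
  simp only [SubmonoidClass.coe_pow, coe_reesMonomial, Polynomial.monomial_pow, one_mul]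
  have : ∀ s : Finset (Fin d), ∏ i ∈ s, Polynomial.monomial (m i) (x i ^ m i) =
      Polynomial.monomial (∑ i ∈ s, m i) (∏ i ∈ s, x i ^ m i) := by
    intro s
    induction s using Finset.cons_induction with
    | empty => simp
    | cons i s hi ih =>
      rw [Finset.prod_cons, Finset.sum_cons, Finset.prod_cons, ih, Polynomial.monomial_mul_monomial]
  rw [this]
  change Polynomial.C a * _ = _
  rw [Polynomial.C_mul_monomial, Finsupp.degree_apply]

theorem coeff_reesHom (hx : ∀ i, x i ∈ I) (P : MvPolynomial (Fin d) R) (n : ℕ) :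
    (reesHom hx P : Polynomial R).coeff n = eval x (homogeneousComponent n P) := by
  induction P using MvPolynomial.induction_on' with
  | monomial m a =>
    rw [coe_reesHom_monomial, Polynomial.coeff_monomial]
    rw [homogeneousComponent_of_mem (n := m.degree) (isHomogeneous_monomial a rfl)]
    split_ifs with h1 h2 h2
    · rfl
    · exact absurd h1.symm h2
    · exact absurd h2.symm h1
    · rw [map_zero]
  | add p q hp hq =>
    rw [map_add, AddMemClass.coe_add, Polynomial.coeff_add, hp, hq, map_add, map_add]

theorem coe_reesHom_of_isHomogeneous (hx : ∀ i, x i ∈ I) {P : MvPolynomial (Fin d) R} {n : ℕ}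
    (hP : P.IsHomogeneous n) : (reesHom hx P : Polynomial R) = Polynomial.monomial n (eval x P) := by
  ext k
  rw [coeff_reesHom, homogeneousComponent_of_mem hP, Polynomial.coeff_monomial]
  split_ifs with h1 h2 h2
  · rfl
  · exact absurd h1.symm h2
  · exact absurd h2.symm h1
  · rw [map_zero]

variable [IsLocalRing R]

/-- The structure map of the fiber cone over the residue field. -/
noncomputable def residueFieldToFiberCone (I : Ideal R) : ResidueField R →+* FiberCone I :=
  Ideal.Quotient.lift (maximalIdeal R) (algebraMap R (FiberCone I)) (by
    intro a ha
    change Ideal.Quotient.mk (fiberConeIdeal I) (algebraMap R (reesAlgebra I) a) = 0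
    rw [Polynomial.coe_mem_fiberConeIdeal_iff]
    intro n
    change (Polynomial.C a).coeff n ∈ _
    rw [Polynomial.coeff_C]
    split_ifs with h
    · subst h
      rw [pow_zero, mul_one]
      exact ha
    · exact Ideal.zero_mem _)

/-- The homomorphism from the polynomial ring over the residue field to the fiber cone mapping
`X i` to the class of `x i t`. -/
noncomputable def fiberConeHom (hx : ∀ i, x i ∈ I) :=
  eval₂Hom (residueFieldToFiberCone I) fun i =>
    Ideal.Quotient.mk (fiberConeIdeal I) (reesMonomial 1 (x i) (by rw [pow_one]; exact hx i))

theorem fiberConeHom_map (hx : ∀ i, x i ∈ I) (P : MvPolynomial (Fin d) R) :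
    fiberConeHom hx (map (residue R) P) = Ideal.Quotient.mk (fiberConeIdeal I) (reesHom hx P) := by
  have : (fiberConeHom hx).comp (map (residue R)) =
      (Ideal.Quotient.mk (fiberConeIdeal I)).comp (reesHom hx).toRingHom := by
    refine MvPolynomial.ringHom_ext ?_ ?_
    · intro r
      rw [RingHom.comp_apply, map_C, fiberConeHom, coe_eval₂Hom, eval₂_C, RingHom.comp_apply]
      change _ = Ideal.Quotient.mk _ (reesHom hx (C r))
      rw [reesHom, aeval_C]
      rfl
    · intro i
      rw [RingHom.comp_apply, map_X, fiberConeHom, coe_eval₂Hom, eval₂_X, RingHom.comp_apply]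
      change _ = Ideal.Quotient.mk _ (reesHom hx (X i))
      rw [reesHom, aeval_X]
  exact congrArg (fun h : _ →+* _ => h P) this

theorem fiberConeHom_X_mem (hx : ∀ i, x i ∈ I) (i : Fin d) :
    fiberConeHom hx (X i) ∈ fiberConeMaximalIdeal I := by
  rw [fiberConeHom, coe_eval₂Hom, eval₂_X]
  refine Ideal.mem_map_of_mem _ ?_
  change (Polynomial.monomial 1 (x i)).coeff 0 ∈ maximalIdeal R
  rw [Polynomial.coeff_monomial, if_neg one_ne_zero]
  exact Ideal.zero_mem _

theorem fiberConeMaximalIdeal_ne_top (I : Ideal R) : fiberConeMaximalIdeal I ≠ ⊤ := by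
  rw [Ideal.ne_top_iff_one]
  intro h
  obtain ⟨r, hr, h1⟩ :=
    (Ideal.mem_map_iff_of_surjective _ Ideal.Quotient.mk_surjective).1 h
  rw [← map_one (Ideal.Quotient.mk (fiberConeIdeal I)), Ideal.Quotient.eq] at h1
  have h2 := h1 0
  rw [pow_zero, mul_one, AddSubgroupClass.coe_sub, Polynomial.coeff_sub] at h2
  have h3 := Ideal.sub_mem _ (show (r : Polynomial R).coeff 0 ∈ maximalIdeal R from hr) h2
  rw [sub_sub_cancel, OneMemClass.coe_one, Polynomial.coeff_one_zero] at h3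
  exact (Ideal.ne_top_iff_one _).1 (maximalIdeal.isMaximal R).ne_top h3

theorem span_range_X_le_comap_fiberConeHom (hx : ∀ i, x i ∈ I) :
    Ideal.span (Set.range (X : Fin d → MvPolynomial (Fin d) (ResidueField R))) ≤
      (fiberConeMaximalIdeal I).comap (fiberConeHom hx) := by
  rw [Ideal.span_le]
  rintro _ ⟨i, rfl⟩
  exact fiberConeHom_X_mem hx i

end FiberConeMaps

/-! ### The map from a free module to the fiber cone -/

section FiberConePresentation

open MvPolynomial

variable {R : Type u} [CommRing R] {I : Ideal R} {d : ℕ} {x : Fin d → R}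

theorem reesMonomial_add {n : ℕ} {a b : R} (ha : a ∈ I ^ n) (hb : b ∈ I ^ n) :
    reesMonomial n (a + b) (Ideal.add_mem _ ha hb) = reesMonomial n a ha + reesMonomial n b hb :=
  Subtype.ext (by simp)

theorem reesHom_mul_reesMonomial (hx : ∀ i, x i ∈ I) {P : MvPolynomial (Fin d) R} {k n : ℕ}
    (hP : P.IsHomogeneous k) {c : R} (hc : c ∈ I ^ n) (h : c * eval x P ∈ I ^ (n + k)) :
    reesHom hx P * reesMonomial n c hc = reesMonomial (n + k) (c * eval x P) h :=
  Subtype.ext (by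
    rw [MulMemClass.coe_mul, coe_reesHom_of_isHomogeneous hx hP, coe_reesMonomial,
      Polynomial.monomial_mul_monomial, coe_reesMonomial, mul_comm c, add_comm k])

variable [IsLocalRing R]

theorem fiberCone_induction {Q : FiberCone I → Prop} (h0 : Q 0)
    (hadd : ∀ a b, Q a → Q b → Q (a + b)) {f : reesAlgebra I}
    (h : ∀ n, Q (Ideal.Quotient.mk (fiberConeIdeal I)
      (reesMonomial n ((f : Polynomial R).coeff n) (f.2 n)))) :
    Q (Ideal.Quotient.mk (fiberConeIdeal I) f) := by
  rw [reesAlgebra.sum_reesMonomial f, map_sum]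
  exact Finset.sum_induction _ Q hadd h0 fun n _ => h n

theorem mk_reesMonomial_induction (hx : ∀ i, x i ∈ I) {Q : FiberCone I → Prop}
    (hadd : ∀ a b, Q a → Q b → Q (a + b)) (hmul : ∀ p a, Q a → Q (fiberConeHom hx p * a))
    {n k : ℕ} {𝔞 : Ideal R} (h𝔞 : 𝔞 ≤ I ^ n)
    (h : ∀ c (hc : c ∈ 𝔞), Q (Ideal.Quotient.mk (fiberConeIdeal I) (reesMonomial n c (h𝔞 hc))))
    {a : R} (ha : a ∈ 𝔞 * Ideal.span (Set.range x) ^ k) (ha' : a ∈ I ^ (n + k)) :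
    Q (Ideal.Quotient.mk (fiberConeIdeal I) (reesMonomial (n + k) a ha')) := by
  have hJI : Ideal.span (Set.range x) ≤ I := Ideal.span_le.2 (by rintro _ ⟨i, rfl⟩; exact hx i)
  have hle : 𝔞 * Ideal.span (Set.range x) ^ k ≤ I ^ (n + k) := by
    rw [pow_add]
    exact Ideal.mul_mono h𝔞 (Ideal.pow_right_mono hJI k)
  suffices ∃ h, Q (Ideal.Quotient.mk (fiberConeIdeal I) (reesMonomial (n + k) a h)) from this.2
  refine Submodule.mul_induction_on ha ?_ ?_
  · intro c hc b hb
    obtain ⟨P, hP, rfl⟩ := exists_eval_eq_of_mem_span_range_pow hb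
    refine ⟨hle (Ideal.mul_mem_mul hc hb), ?_⟩
    rw [← reesHom_mul_reesMonomial hx hP (h𝔞 hc), map_mul, ← fiberConeHom_map]
    exact hmul _ _ (h c hc)
  · rintro a b ⟨h1, h2⟩ ⟨h1', h2'⟩
    refine ⟨Ideal.add_mem _ h1 h1', ?_⟩
    rw [reesMonomial_add h1 h1', map_add]
    exact hadd _ _ h2 h2'

/-- The ideals `J ^ (n - 1) I + 𝔪 I ^ n`, the unit ideal for `n = 0`. -/
def stepIdeal (I J : Ideal R) : ℕ → Ideal R
  | 0 => ⊤
  | n + 1 => I * J ^ n ⊔ maximalIdeal R * I ^ (n + 1)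

theorem maximalIdeal_mul_pow_le_stepIdeal (I J : Ideal R) (n : ℕ) :
    maximalIdeal R * I ^ n ≤ stepIdeal I J n := by
  cases n
  exacts [le_top, le_sup_right]

/-- The step ideals describe the image of the presentation map degree by degree; this is its
stability under the polynomial ring. -/
theorem mul_stepIdeal_le {I J : Ideal R} (hJI : J ≤ I) (a b : ℕ) :
    J ^ a * stepIdeal I J b ≤ stepIdeal I J (a + b) := by
  obtain _ | b := b
  · refine Ideal.mul_le_left.trans ?_
    obtain _ | a := a
    · exact le_top
    · refine le_sup_of_le_left ?_
      rw [pow_succ']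
      exact Ideal.mul_mono_left hJI
  · change J ^ a * (I * J ^ b ⊔ maximalIdeal R * I ^ (b + 1)) ≤
      I * J ^ (a + b) ⊔ maximalIdeal R * I ^ (a + b + 1)
    rw [Ideal.mul_sup, mul_left_comm, ← pow_add, mul_left_comm, add_assoc, pow_add I a (b + 1)]
    exact sup_le_sup_left (Ideal.mul_mono_right (Ideal.mul_mono_left (Ideal.pow_right_mono hJI a))) _

variable {r : ℕ} {z : Fin r → R}

/-- The linear form on `S × S ^ r` over the polynomial ring `S` with values in the fiber cone that
maps the basis to `1` and the classes of `z j t`. -/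
noncomputable def presentationMap (hx : ∀ i, x i ∈ I) (hz : ∀ j, z j ∈ I)
    (p : MvPolynomial (Fin d) (ResidueField R) × (Fin r → MvPolynomial (Fin d) (ResidueField R))) :
    FiberCone I :=
  fiberConeHom hx p.1 + ∑ j, fiberConeHom hx (p.2 j) *
    Ideal.Quotient.mk (fiberConeIdeal I) (reesMonomial 1 (z j) (by rw [pow_one]; exact hz j))

/-- The coefficients of the Rees algebra element given by `P₀` and `P`. -/
noncomputable def presentationCoeff (x : Fin d → R) (z : Fin r → R) (P₀ : MvPolynomial (Fin d) R)
    (P : Fin r → MvPolynomial (Fin d) R) : ℕ → R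
  | 0 => eval x (homogeneousComponent 0 P₀)
  | n + 1 => eval x (homogeneousComponent (n + 1) P₀) +
      ∑ j, eval x (homogeneousComponent n (P j)) * z j

/-- Equality in the fiber cone is tested degree by degree in R. Because z_j t has degree one, the
components of `P` are shifted by one against those of `P₀`. -/
theorem mk_eq_presentationMap_iff (hx : ∀ i, x i ∈ I) (hz : ∀ j, z j ∈ I) (f : reesAlgebra I)
    (P₀ : MvPolynomial (Fin d) R) (P : Fin r → MvPolynomial (Fin d) R) :
    Ideal.Quotient.mk (fiberConeIdeal I) f =
        presentationMap hx hz (map (residue R) P₀, fun j => map (residue R) (P j)) ↔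
      ∀ n, (f : Polynomial R).coeff n - presentationCoeff x z P₀ P n ∈ maximalIdeal R * I ^ n := by
  have h1 : presentationMap hx hz (map (residue R) P₀, fun j => map (residue R) (P j)) =
      Ideal.Quotient.mk (fiberConeIdeal I) (reesHom hx P₀ + ∑ j, reesHom hx (P j) *
        reesMonomial 1 (z j) (by rw [pow_one]; exact hz j)) := by
    simp only [presentationMap, fiberConeHom_map, map_add, map_sum, map_mul]
  rw [h1, Ideal.Quotient.eq]
  refine forall_congr' fun n => ?_
  rw [AddSubgroupClass.coe_sub, Polynomial.coeff_sub, AddMemClass.coe_add, Polynomial.coeff_add,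
    coeff_reesHom, AddSubmonoidClass.coe_finsetSum, Polynomial.finsetSum_coeff]
  simp only [MulMemClass.coe_mul, coe_reesMonomial]
  cases n with
  | zero => simp [presentationCoeff, Polynomial.mul_coeff_zero, Polynomial.coeff_monomial]
  | succ n => simp only [Polynomial.coeff_mul_monomial, coeff_reesHom, presentationCoeff]

theorem exists_map_residue_eq
    (p : MvPolynomial (Fin d) (ResidueField R) × (Fin r → MvPolynomial (Fin d) (ResidueField R))) :
    ∃ (P₀ : MvPolynomial (Fin d) R) (P : Fin r → MvPolynomial (Fin d) R),
      p = (map (residue R) P₀, fun j => map (residue R) (P j)) := by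
  have hs := map_surjective (σ := Fin d) (residue R) residue_surjective
  obtain ⟨P₀, h₀⟩ := hs p.1
  choose P hP using fun j => hs (p.2 j)
  exact ⟨P₀, P, Prod.ext h₀.symm (funext fun j => (hP j).symm)⟩

theorem presentationMap_add (hx : ∀ i, x i ∈ I) (hz : ∀ j, z j ∈ I)
    (p q : MvPolynomial (Fin d) (ResidueField R) ×
      (Fin r → MvPolynomial (Fin d) (ResidueField R))) :
    presentationMap hx hz (p + q) = presentationMap hx hz p + presentationMap hx hz q := by
  simp only [presentationMap, Prod.fst_add, Prod.snd_add, Pi.add_apply, map_add, add_mul,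
    Finset.sum_add_distrib]
  ring

theorem presentationMap_smul (hx : ∀ i, x i ∈ I) (hz : ∀ j, z j ∈ I)
    (c : MvPolynomial (Fin d) (ResidueField R)) (p : MvPolynomial (Fin d) (ResidueField R) ×
      (Fin r → MvPolynomial (Fin d) (ResidueField R))) :
    presentationMap hx hz (c • p) = fiberConeHom hx c * presentationMap hx hz p := by
  simp only [presentationMap, Prod.smul_fst, Prod.smul_snd, Pi.smul_apply, smul_eq_mul, map_mul,
    mul_add, Finset.mul_sum, mul_assoc]

end FiberConePresentation

/-! ### Homogeneous relations and the image of the presentation map -/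

section FiberConePresentationExact

open MvPolynomial

variable {R : Type u} [CommRing R] {I : Ideal R} {d : ℕ} {x : Fin d → R} {r : ℕ}
  {z : Fin r → R}

theorem presentationCoeff_of_isHomogeneous {n : ℕ} {P₀ : MvPolynomial (Fin d) R}
    (h₀ : P₀.IsHomogeneous (n + 1)) {P : Fin r → MvPolynomial (Fin d) R}
    (hP : ∀ j, (P j).IsHomogeneous n) (k : ℕ) : presentationCoeff x z P₀ P k =
      if k = n + 1 then eval x P₀ + ∑ j, eval x (P j) * z j else 0 := by
  obtain _ | k := k
  · simp [presentationCoeff, homogeneousComponent_of_mem h₀]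
  · have h1 : ∀ j, homogeneousComponent k (P j) = if k = n then P j else 0 := fun j =>
      homogeneousComponent_of_mem (hP j)
    simp only [presentationCoeff, homogeneousComponent_of_mem h₀, h1, Nat.add_right_cancel_iff]
    split_ifs <;> simp

variable [IsLocalRing R]

/-- Write the given element of 𝔪IJ^n as q(x) with coefficients in 𝔪I. The form W = Σ z_j P_j - q
takes a value in J^(n+1), so its coefficients lie in J, and independence of the z_j modulo J + 𝔪I
puts those of P_j in 𝔪. Then W has coefficients in J ∩ 𝔪I, which is contained in 𝔪J by independence
of the x_i. Hence P₀(x) lies in 𝔪J^(n+1), and quasi-regularity applies once more. -/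
theorem QuasiRegular.coeff_mem_maximalIdeal_of_eval_add_sum_mem (hQ : QuasiRegular x)
    (hJm : Ideal.span (Set.range x) ≤ maximalIdeal R)
    (hx : ∀ a : Fin d → R, ∑ i, a i * x i ∈ maximalIdeal R * I → ∀ i, a i ∈ maximalIdeal R)
    (hzI : ∀ j, z j ∈ I)
    (hz : ∀ a : Fin r → R, ∑ j, a j * z j ∈ Ideal.span (Set.range x) ⊔ maximalIdeal R * I →
      ∀ j, a j ∈ maximalIdeal R) {n : ℕ}
    {P₀ : MvPolynomial (Fin d) R} (h₀ : P₀.IsHomogeneous (n + 1))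
    {P : Fin r → MvPolynomial (Fin d) R} (hP : ∀ j, (P j).IsHomogeneous n)
    (he : eval x P₀ + ∑ j, eval x (P j) * z j ∈
      maximalIdeal R * I * Ideal.span (Set.range x) ^ n) :
    (∀ m, coeff m P₀ ∈ maximalIdeal R) ∧ ∀ j m, coeff m (P j) ∈ maximalIdeal R := by
  set J := Ideal.span (Set.range x) with hJ
  obtain ⟨q, hq, hqI, hqe⟩ := exists_eval_eq_of_mem_mul_span_range_pow he
  have hW : (∑ j, C (z j) * P j - q).IsHomogeneous n :=
    (IsHomogeneous.sum _ _ _ fun j _ => (hP j).C_mul _).sub hq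
  have hWe : eval x (∑ j, C (z j) * P j - q) = - eval x P₀ := by
    rw [map_sub, hqe, map_sum]
    simp only [map_mul, eval_C, mul_comm (z _)]
    ring
  have hWJ : ∀ m, coeff m (∑ j, C (z j) * P j - q) ∈ J := by
    refine hQ.coeff_mem le_rfl hW ?_
    rw [hWe, ← pow_succ']
    exact neg_mem (eval_mem_span_range_pow h₀)
  have hcW : ∀ m, coeff m (∑ j, C (z j) * P j - q) = ∑ j, coeff m (P j) * z j - coeff m q := by
    intro m
    rw [coeff_sub, coeff_sum]
    simp only [coeff_C_mul, mul_comm (z _)]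
  have hPm : ∀ j m, coeff m (P j) ∈ maximalIdeal R := by
    intro j m
    refine hz (fun j => coeff m (P j)) ?_ j
    have := hWJ m
    rw [hcW] at this
    rw [← sub_add_cancel (∑ j, coeff m (P j) * z j) (coeff m q)]
    exact Submodule.add_mem_sup this (hqI m)
  refine ⟨?_, hPm⟩
  refine hQ.coeff_mem hJm h₀ ?_
  rw [← neg_mem_iff, ← hWe, pow_succ', ← mul_assoc]
  refine eval_mem_mul_span_range_pow hW fun m => ?_
  have h1 : coeff m (∑ j, C (z j) * P j - q) ∈ maximalIdeal R * I := by
    rw [hcW]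
    exact Ideal.sub_mem _ (Ideal.sum_mem _ fun j _ => Ideal.mul_mem_mul (hPm j m) (hzI j)) (hqI m)
  obtain ⟨a, ha⟩ := (Ideal.mem_span_range_iff_exists_fun).1 (hWJ m)
  rw [← ha] at h1 ⊢
  exact Ideal.sum_mem _ fun i _ =>
    Ideal.mul_mem_mul (hx a h1 i) (Ideal.subset_span (Set.mem_range_self i))

theorem presentationMap_eq_zero (hxI : ∀ i, x i ∈ I) (hzI : ∀ j, z j ∈ I) {n : ℕ}
    {P₀ : MvPolynomial (Fin d) R} (h₀ : P₀.IsHomogeneous (n + 1))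
    {P : Fin r → MvPolynomial (Fin d) R} (hP : ∀ j, (P j).IsHomogeneous n)
    (he : eval x P₀ + ∑ j, eval x (P j) * z j ∈ maximalIdeal R * I ^ (n + 1)) :
    presentationMap hxI hzI (map (residue R) P₀, fun j => map (residue R) (P j)) = 0 := by
  rw [← map_zero (Ideal.Quotient.mk (fiberConeIdeal I)), eq_comm, mk_eq_presentationMap_iff]
  intro k
  rw [presentationCoeff_of_isHomogeneous h₀ hP, ZeroMemClass.coe_zero, Polynomial.coeff_zero,
    zero_sub, neg_mem_iff]
  split_ifs with h
  · exact h ▸ he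
  · exact Ideal.zero_mem _

theorem MvPolynomial.sum_range_homogeneousComponent {σ A : Type*} [CommSemiring A]
    (p : MvPolynomial σ A) {N : ℕ} (hN : p.totalDegree < N) :
    ∑ n ∈ Finset.range N, homogeneousComponent n p = p := by
  conv_rhs => rw [← sum_homogeneousComponent p]
  symm
  refine Finset.sum_subset (Finset.range_subset_range.2 hN) fun n _ hn => ?_
  exact homogeneousComponent_eq_zero _ _ (by simpa using hn)

theorem mem_span_of_presentationMap_eq_zero (hxI : ∀ i, x i ∈ I) (hzI : ∀ j, z j ∈ I)
    (T : Submodule (MvPolynomial (Fin d) (ResidueField R))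
      (MvPolynomial (Fin d) (ResidueField R) × (Fin r → MvPolynomial (Fin d) (ResidueField R))))
    (hT : ∀ (n : ℕ) (P₀ : MvPolynomial (Fin d) R) (P : Fin r → MvPolynomial (Fin d) R),
      P₀.IsHomogeneous (n + 1) → (∀ j, (P j).IsHomogeneous n) →
      eval x P₀ + ∑ j, eval x (P j) * z j ∈ maximalIdeal R * I ^ (n + 1) →
      (map (residue R) P₀, fun j => map (residue R) (P j)) ∈ T)
    (p : MvPolynomial (Fin d) (ResidueField R) × (Fin r → MvPolynomial (Fin d) (ResidueField R)))
    (hp : presentationMap hxI hzI p = 0) : p ∈ T := by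
  obtain ⟨P₀, P, rfl⟩ := exists_map_residue_eq p
  rw [← map_zero (Ideal.Quotient.mk (fiberConeIdeal I)), eq_comm, mk_eq_presentationMap_iff] at hp
  simp only [ZeroMemClass.coe_zero, Polynomial.coeff_zero, zero_sub, neg_mem_iff] at hp
  let N := P₀.totalDegree + ∑ j, (P j).totalDegree + 1
  have h1 : ∑ n ∈ Finset.range (N + 1), homogeneousComponent n P₀ = P₀ :=
    sum_range_homogeneousComponent _ (by omega)
  have h2 : ∀ j, ∑ n ∈ Finset.range N, homogeneousComponent n (P j) = P j := fun j =>
    sum_range_homogeneousComponent _ (by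
      have := Finset.single_le_sum (f := fun j => (P j).totalDegree) (fun _ _ => Nat.zero_le _)
        (Finset.mem_univ j)
      omega)
  -- The degree 0 part involves only the constant term of `P₀`, so relations start in degree one.
  have h3 : map (residue R) (homogeneousComponent 0 P₀) = 0 := by
    have := hp 0
    rw [presentationCoeff, homogeneousComponent_zero, eval_C, pow_zero, mul_one] at this
    rw [homogeneousComponent_zero, map_C, (residue_eq_zero_iff _).2 this, C_0]
  have h4 : (map (residue R) P₀, fun j => map (residue R) (P j)) = ∑ n ∈ Finset.range N,
      (map (residue R) (homogeneousComponent (n + 1) P₀),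
        fun j => map (residue R) (homogeneousComponent n (P j))) := by
    refine Prod.ext ?_ ?_
    · rw [Prod.fst_sum, ← map_sum]
      conv_lhs => rw [← h1, Finset.sum_range_succ', map_add, h3, add_zero]
    · rw [Prod.snd_sum]
      funext j
      rw [Finset.sum_apply, ← map_sum, h2]
  rw [h4]
  exact T.sum_mem fun n _ => hT n _ _ (homogeneousComponent_isHomogeneous _ _)
    (fun j => homogeneousComponent_isHomogeneous _ _) (hp (n + 1))

theorem presentationCoeff_mem_stepIdeal (hxI : ∀ i, x i ∈ I) (hzI : ∀ j, z j ∈ I)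
    (P₀ : MvPolynomial (Fin d) R) (P : Fin r → MvPolynomial (Fin d) R) (n : ℕ) :
    presentationCoeff x z P₀ P n ∈ stepIdeal I (Ideal.span (Set.range x)) n := by
  have hJI : Ideal.span (Set.range x) ≤ I := Ideal.span_le.2 (by rintro _ ⟨i, rfl⟩; exact hxI i)
  obtain _ | n := n
  · exact trivial
  · refine Ideal.mem_sup_left (Ideal.add_mem _ ?_ (Ideal.sum_mem _ fun j _ => ?_))
    · refine Ideal.mul_mono_left hJI ?_
      rw [← pow_succ']
      exact eval_mem_span_range_pow (homogeneousComponent_isHomogeneous _ _)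
    · rw [mul_comm I]
      exact Ideal.mul_mem_mul
        (eval_mem_span_range_pow (homogeneousComponent_isHomogeneous _ _)) (hzI j)

theorem exists_sub_eval_add_sum_mem
    (hzs : I ≤ Ideal.span (Set.range z) ⊔ (Ideal.span (Set.range x) ⊔ maximalIdeal R * I)) {n : ℕ}
    {a : R} (ha : a ∈ I * Ideal.span (Set.range x) ^ n) :
    ∃ (P₀ : MvPolynomial (Fin d) R) (P : Fin r → MvPolynomial (Fin d) R),
      P₀.IsHomogeneous (n + 1) ∧ (∀ j, (P j).IsHomogeneous n) ∧
      a - (eval x P₀ + ∑ j, eval x (P j) * z j) ∈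
        maximalIdeal R * I * Ideal.span (Set.range x) ^ n := by
  refine Submodule.mul_induction_on ha ?_ ?_
  · intro c hc y hy
    obtain ⟨B, hB, rfl⟩ := exists_eval_eq_of_mem_span_range_pow hy
    obtain ⟨e, he, c', hc', rfl⟩ := Submodule.mem_sup.1 (hzs hc)
    obtain ⟨f, hf, c'', hc'', rfl⟩ := Submodule.mem_sup.1 hc'
    obtain ⟨a, rfl⟩ := Ideal.mem_span_range_iff_exists_fun.1 he
    obtain ⟨b, rfl⟩ := Ideal.mem_span_range_iff_exists_fun.1 hf
    refine ⟨B * ∑ i, C (b i) * X i, fun j => C (a j) * B,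
      hB.mul (IsHomogeneous.sum _ _ _ fun i _ => (isHomogeneous_X R i).C_mul _),
      fun j => hB.C_mul _, ?_⟩
    convert Ideal.mul_mem_mul hc'' hy using 1
    simp only [map_mul, map_sum, eval_C, eval_X, add_mul, Finset.sum_mul, mul_right_comm (a _),
      mul_comm (eval x B)]
    ring
  · rintro a b ⟨P₀, P, h₀, hP, h⟩ ⟨P₀', P', h₀', hP', h'⟩
    refine ⟨P₀ + P₀', fun j => P j + P' j, h₀.add h₀', fun j => (hP j).add (hP' j), ?_⟩
    convert Ideal.add_mem _ h h' using 1
    simp only [map_add, add_mul, Finset.sum_add_distrib]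
    ring

theorem mk_reesMonomial_mem_range (hxI : ∀ i, x i ∈ I) (hzI : ∀ j, z j ∈ I)
    (hzs : I ≤ Ideal.span (Set.range z) ⊔ (Ideal.span (Set.range x) ⊔ maximalIdeal R * I)) {n : ℕ}
    {a : R} (ha : a ∈ I ^ n) (h : a ∈ stepIdeal I (Ideal.span (Set.range x)) n) :
    ∃ q, Ideal.Quotient.mk (fiberConeIdeal I) (reesMonomial n a ha) =
      presentationMap hxI hzI q := by
  obtain _ | n := n
  · refine ⟨(map (residue R) (C a), fun j => map (residue R) 0), ?_⟩
    rw [mk_eq_presentationMap_iff]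
    rintro (_ | n)
    · simp [presentationCoeff]
    · simp [presentationCoeff,
        homogeneousComponent_of_mem (isHomogeneous_C (Fin d) a)]
  · have hJI : Ideal.span (Set.range x) ≤ I :=
      Ideal.span_le.2 (by rintro _ ⟨i, rfl⟩; exact hxI i)
    obtain ⟨b, hb, c, hc, rfl⟩ := Submodule.mem_sup.1 h
    obtain ⟨P₀, P, h₀, hP, hb⟩ := exists_sub_eval_add_sum_mem hzs hb
    have hle : maximalIdeal R * I * Ideal.span (Set.range x) ^ n ≤ maximalIdeal R * I ^ (n + 1) := by
      rw [pow_succ', mul_assoc]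
      exact Ideal.mul_mono_right (Ideal.mul_mono_right (Ideal.pow_right_mono hJI n))
    refine ⟨(map (residue R) P₀, fun j => map (residue R) (P j)), ?_⟩
    rw [mk_eq_presentationMap_iff]
    intro k
    rw [presentationCoeff_of_isHomogeneous h₀ hP, coe_reesMonomial, Polynomial.coeff_monomial]
    obtain rfl | hk := eq_or_ne k (n + 1)
    · rw [if_pos rfl, if_pos rfl, add_sub_right_comm]
      exact Ideal.add_mem _ (hle hb) hc
    · rw [if_neg hk.symm, if_neg hk, sub_zero]
      exact Ideal.zero_mem _

theorem exists_mk_eq_presentationMap_iff (hxI : ∀ i, x i ∈ I) (hzI : ∀ j, z j ∈ I)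
    (hzs : I ≤ Ideal.span (Set.range z) ⊔ (Ideal.span (Set.range x) ⊔ maximalIdeal R * I))
    (f : reesAlgebra I) :
    (∃ q, Ideal.Quotient.mk (fiberConeIdeal I) f = presentationMap hxI hzI q) ↔
      ∀ n, (f : Polynomial R).coeff n ∈ stepIdeal I (Ideal.span (Set.range x)) n := by
  constructor
  · rintro ⟨q, hq⟩ n
    obtain ⟨P₀, P, rfl⟩ := exists_map_residue_eq q
    rw [mk_eq_presentationMap_iff] at hq
    rw [← sub_add_cancel ((f : Polynomial R).coeff n) (presentationCoeff x z P₀ P n)]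
    exact Ideal.add_mem _ (maximalIdeal_mul_pow_le_stepIdeal _ _ _ (hq n))
      (presentationCoeff_mem_stepIdeal hxI hzI P₀ P n)
  · intro h
    refine fiberCone_induction (Q := fun a => ∃ q, a = presentationMap hxI hzI q) ?_ ?_ fun n =>
      mk_reesMonomial_mem_range hxI hzI hzs _ (h n)
    · exact ⟨0, by simp [presentationMap]⟩
    · rintro _ _ ⟨p, rfl⟩ ⟨q, rfl⟩
      exact ⟨p + q, (presentationMap_add hxI hzI p q).symm⟩

end FiberConePresentationExact

/-! ### Torsion-freeness of the cokernel, the cyclic kernel, and generators -/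

section FiberConePresentationCases

open MvPolynomial

variable {R : Type u} [CommRing R] [IsLocalRing R] {I : Ideal R} {d : ℕ} {x : Fin d → R} {r : ℕ}
  {z : Fin r → R}

/-- Reduction to homogeneous elements: take the lowest component of f with a unit coefficient and
the lowest component of s outside the step ideal. In the sum of their degrees every other product
lies in the step ideal, so this one does too. -/
theorem eq_zero_or_exists_eq_presentationMap (hxI : ∀ i, x i ∈ I) (hzI : ∀ j, z j ∈ I)
    (hzs : I ≤ Ideal.span (Set.range z) ⊔ (Ideal.span (Set.range x) ⊔ maximalIdeal R * I))
    (h : ∀ (k n : ℕ) (f : MvPolynomial (Fin d) R) (s : R), f.IsHomogeneous k →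
      (∃ m, coeff m f ∉ maximalIdeal R) → s ∈ I ^ n →
      eval x f * s ∈ stepIdeal I (Ideal.span (Set.range x)) (k + n) →
      s ∈ stepIdeal I (Ideal.span (Set.range x)) n)
    (p : MvPolynomial (Fin d) (ResidueField R)) (c : FiberCone I)
    (hc : ∃ q, fiberConeHom hxI p * c = presentationMap hxI hzI q) :
    p = 0 ∨ ∃ q, c = presentationMap hxI hzI q := by
  classical
  set J := Ideal.span (Set.range x) with hJ
  have hJI : J ≤ I := Ideal.span_le.2 (by rintro _ ⟨i, rfl⟩; exact hxI i)
  obtain ⟨f, rfl⟩ := map_surjective (σ := Fin d) (residue R) residue_surjective p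
  obtain ⟨s, rfl⟩ := Ideal.Quotient.mk_surjective c
  rw [fiberConeHom_map, ← map_mul] at hc
  rw [exists_mk_eq_presentationMap_iff hxI hzI hzs] at hc ⊢
  by_contra! hne
  obtain ⟨hp, hs⟩ := hne
  have hf : ∃ i, ∃ m, coeff m (homogeneousComponent i f) ∉ maximalIdeal R := by
    by_contra! hf
    refine hp (MvPolynomial.ext _ _ fun m => ?_)
    rw [coeff_map, coeff_zero, residue_eq_zero_iff]
    have := hf m.degree m
    rwa [coeff_homogeneousComponent, if_pos rfl] at this
  refine Nat.find_spec hs (h (Nat.find hf) _ _ _ (homogeneousComponent_isHomogeneous _ f)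
    (Nat.find_spec hf) (s.2 _) ?_)
  have hsum := hc (Nat.find hf + Nat.find hs)
  rw [MulMemClass.coe_mul, Polynomial.coeff_mul, ← Finset.add_sum_erase _ _
    (Finset.HasAntidiagonal.mem_antidiagonal.2
      (rfl : (Nat.find hf, Nat.find hs).1 + (Nat.find hf, Nat.find hs).2 = _))] at hsum
  rw [← coeff_reesHom hxI]
  refine (Ideal.add_mem_iff_left _ (Ideal.sum_mem _ ?_)).1 hsum
  rintro ⟨a, b⟩ hab
  rw [Finset.mem_erase, Finset.HasAntidiagonal.mem_antidiagonal] at hab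
  obtain ⟨hne, hab⟩ := hab
  dsimp only at hab ⊢
  rw [← hab, coeff_reesHom]
  obtain hb | hb := lt_or_ge b (Nat.find hs)
  · exact mul_stepIdeal_le hJI a b (Ideal.mul_mem_mul
      (eval_mem_span_range_pow (homogeneousComponent_isHomogeneous a f))
      (not_not.1 (Nat.find_min hs hb)))
  · have ha : a < Nat.find hf := by
      by_contra ha
      exact hne (Prod.ext (by dsimp only; omega) (by dsimp only; omega))
    have hm := Nat.find_min hf ha
    push Not at hm
    refine maximalIdeal_mul_pow_le_stepIdeal _ _ _ ?_
    rw [pow_add, ← mul_assoc]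
    exact Ideal.mul_mem_mul (Ideal.mul_mono_right (Ideal.pow_right_mono hJI a)
      (eval_mem_mul_span_range_pow (homogeneousComponent_isHomogeneous a f) hm)) (s.2 b)

/-- Here the summand 𝔪I^n is absorbed by IJ^(n-1) from degree two on, and f is a nonzerodivisor on ⨁
R/IJ^n. -/
theorem QuasiRegular.mem_stepIdeal_of_maximalIdeal_mul_sq_le (hQ : QuasiRegular x)
    (hxI : ∀ i, x i ∈ I) (hI : ∀ n, I ^ (n + 2) = I ^ 2 * Ideal.span (Set.range x) ^ n)
    (hmI : maximalIdeal R * I ^ 2 ≤ I * Ideal.span (Set.range x))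
    {k n : ℕ} {f : MvPolynomial (Fin d) R} {s : R} (hf : f.IsHomogeneous k)
    (hfu : ∃ m, coeff m f ∉ maximalIdeal R) (hs : s ∈ I ^ n)
    (hfs : eval x f * s ∈ stepIdeal I (Ideal.span (Set.range x)) (k + n)) :
    s ∈ stepIdeal I (Ideal.span (Set.range x)) n := by
  set J := Ideal.span (Set.range x) with hJ
  have hJI : J ≤ I := Ideal.span_le.2 (by rintro _ ⟨i, rfl⟩; exact hxI i)
  obtain _ | _ | n := n
  · trivial
  · refine Ideal.mem_sup_left ?_
    simpa using hs
  · refine Ideal.mem_sup_left (hQ.mem_of_eval_mul_mem hJI hf hfu ?_)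
    obtain ⟨b, hb, c, hc, hbc⟩ := Submodule.mem_sup.1 hfs
    rw [← hbc]
    refine Ideal.add_mem _ hb ?_
    change c ∈ maximalIdeal R * I ^ (k + n + 2) at hc
    rw [hI, ← mul_assoc] at hc
    have := Ideal.mul_mono_left hmI hc
    rwa [mul_assoc, ← pow_succ'] at this

theorem QuasiRegular.mem_stepIdeal_of_notMem (hQ : QuasiRegular x)
    (hxI : ∀ i, x i ∈ I) (hI : ∀ n, I ^ (n + 2) = I ^ 2 * Ideal.span (Set.range x) ^ n)
    (hmI : maximalIdeal R * (maximalIdeal R * I ^ 2) ≤ I * Ideal.span (Set.range x)) {w : R}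
    (hw : w ∈ I ^ 2) (hIw : I ^ 2 ≤ Ideal.span {w} ⊔ stepIdeal I (Ideal.span (Set.range x)) 2)
    {a : R} (ha : a ∈ maximalIdeal R) (haw : a * w ∉ I * Ideal.span (Set.range x))
    {k n : ℕ} {f : MvPolynomial (Fin d) R} {s : R} (hf : f.IsHomogeneous k)
    (hfu : ∃ m, coeff m f ∉ maximalIdeal R) (hs : s ∈ I ^ n)
    (hfs : eval x f * s ∈ stepIdeal I (Ideal.span (Set.range x)) (k + n)) :
    s ∈ stepIdeal I (Ideal.span (Set.range x)) n := by
  set J := Ideal.span (Set.range x) with hJ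
  have hJI : J ≤ I := Ideal.span_le.2 (by rintro _ ⟨i, rfl⟩; exact hxI i)
  obtain _ | _ | n := n
  · trivial
  · refine Ideal.mem_sup_left ?_
    simpa using hs
  · rw [hI] at hs
    have h1 := Ideal.mul_mono_left (K := J ^ n) hIw hs
    rw [Ideal.sup_mul] at h1
    obtain ⟨b, hb, c, hc, rfl⟩ := Submodule.mem_sup.1 h1
    obtain ⟨y, hy, rfl⟩ := Ideal.mem_span_singleton_mul.1 hb
    obtain ⟨p, hp, rfl⟩ := exists_eval_eq_of_mem_span_range_pow hy
    have hc' : c ∈ stepIdeal I J (n + 2) := by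
      refine mul_stepIdeal_le hJI n 2 ?_
      rwa [mul_comm]
    refine Ideal.add_mem _ ?_ hc'
    have hfc : eval x f * c ∈ stepIdeal I J (k + (n + 2)) :=
      mul_stepIdeal_le hJI k (n + 2) (Ideal.mul_mem_mul (eval_mem_span_range_pow hf) hc')
    rw [mul_add, Ideal.add_mem_iff_left _ hfc] at hfs
    -- Modulo the step ideal s is w p(x). If p had a unit coefficient, multiplying by a would push
    -- the error term into a power of J times I, since 𝔪²I² ≤ IJ, and cancelling f p would give a w
    -- in IJ.
    by_cases hpu : ∃ m, coeff m p ∉ maximalIdeal R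
    · refine absurd ?_ haw
      rw [← pow_one J]
      refine hQ.mem_of_eval_mul_mem hJI (hf.mul hp) (exists_coeff_mul_notMem hfu hpu) ?_
      obtain ⟨b, hb, c, hc, hbc⟩ := Submodule.mem_sup.1 hfs
      rw [map_mul, show eval x f * eval x p * (a * w) = a * (eval x f * (w * eval x p)) by ring,
        ← hbc, mul_add]
      refine Ideal.add_mem _ (Ideal.mul_mem_left _ _ hb) ?_
      change c ∈ maximalIdeal R * I ^ (k + n + 2) at hc
      have h2 := Ideal.mul_mem_mul ha hc
      rw [hI, ← mul_assoc, ← mul_assoc, mul_assoc (maximalIdeal R)] at h2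
      have := Ideal.mul_mono_left hmI h2
      rwa [mul_assoc, ← pow_succ'] at this
    · push Not at hpu
      refine maximalIdeal_mul_pow_le_stepIdeal _ _ _ ?_
      rw [hI, mul_left_comm]
      exact Ideal.mul_mem_mul hw (eval_mem_mul_span_range_pow hp hpu)

theorem mul_pow_le_of_mul_sq_le (hI : ∀ n, I ^ (n + 2) = I ^ 2 * Ideal.span (Set.range x) ^ n)
    {u : R} (hu : maximalIdeal R * I ^ 2 ≤
      Ideal.span {u} ⊔ maximalIdeal R * (I * Ideal.span (Set.range x))) (n : ℕ) {e : R}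
    (he : e ∈ maximalIdeal R * I ^ (n + 2)) : ∃ h : MvPolynomial (Fin d) R, h.IsHomogeneous n ∧
      e - eval x h * u ∈ maximalIdeal R * I * Ideal.span (Set.range x) ^ (n + 1) := by
  rw [hI, ← mul_assoc] at he
  have h1 := Ideal.mul_mono_left hu he
  rw [Ideal.sup_mul] at h1
  obtain ⟨b, hb, c, hc, rfl⟩ := Submodule.mem_sup.1 h1
  obtain ⟨y, hy, rfl⟩ := Ideal.mem_span_singleton_mul.1 hb
  obtain ⟨h, hh, rfl⟩ := exists_eval_eq_of_mem_span_range_pow hy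
  refine ⟨h, hh, ?_⟩
  rw [mul_comm u, add_sub_cancel_left, pow_succ', ← mul_assoc, mul_assoc (maximalIdeal R)]
  exact hc

theorem map_residue_eq_zero_of_coeff_mem {P : MvPolynomial (Fin d) R}
    (h : ∀ m, coeff m P ∈ maximalIdeal R) : map (residue R) P = 0 :=
  MvPolynomial.ext _ _ fun m => by
    rw [coeff_map, coeff_zero, residue_eq_zero_iff]
    exact h m

/-- A relation in degree n + 2 has its value in 𝔪I²J^n, that is, equal to h(x) u modulo 𝔪IJ^(n+1).
If u lies in IJ, it defines a relation g, and subtracting h g leaves a trivial relation. Otherwise h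
has no unit coefficient, as cancelling it would give u in IJ; then h(x) u is itself in 𝔪IJ^(n+1),
and the relation is trivial. -/
theorem QuasiRegular.exists_ker_presentationMap (hQ : QuasiRegular x)
    (hJm : Ideal.span (Set.range x) ≤ maximalIdeal R)
    (hx : ∀ a : Fin d → R, ∑ i, a i * x i ∈ maximalIdeal R * I → ∀ i, a i ∈ maximalIdeal R)
    (hz : ∀ a : Fin r → R, ∑ j, a j * z j ∈ Ideal.span (Set.range x) ⊔ maximalIdeal R * I →
      ∀ j, a j ∈ maximalIdeal R)
    (hxI : ∀ i, x i ∈ I) (hzI : ∀ j, z j ∈ I)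
    (hzs : I ≤ Ideal.span (Set.range z) ⊔ (Ideal.span (Set.range x) ⊔ maximalIdeal R * I))
    (hI : ∀ n, I ^ (n + 2) = I ^ 2 * Ideal.span (Set.range x) ^ n) {u : R}
    (hu : u ∈ maximalIdeal R * I ^ 2)
    (hle : maximalIdeal R * I ^ 2 ≤
      Ideal.span {u} ⊔ maximalIdeal R * (I * Ideal.span (Set.range x)))
    (hcase : u ∈ I * Ideal.span (Set.range x) ∨ u ∉ I * Ideal.span (Set.range x) ∧
      ∀ a ∈ maximalIdeal R, a * u ∈ maximalIdeal R * (I * Ideal.span (Set.range x))) :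
    ∃ g, presentationMap hxI hzI g = 0 ∧
      ∀ p, presentationMap hxI hzI p = 0 → p ∈ Submodule.span (MvPolynomial (Fin d) (ResidueField R)) {g} := by
  set J := Ideal.span (Set.range x) with hJ
  have hJI : J ≤ I := Ideal.span_le.2 (by rintro _ ⟨i, rfl⟩; exact hxI i)
  have hinj : ∀ (n : ℕ) (P₀ : MvPolynomial (Fin d) R) (P : Fin r → MvPolynomial (Fin d) R),
      P₀.IsHomogeneous (n + 1) → (∀ j, (P j).IsHomogeneous n) →
      eval x P₀ + ∑ j, eval x (P j) * z j ∈ maximalIdeal R * I * J ^ n →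
      (map (residue R) P₀, fun j => map (residue R) (P j)) = 0 := by
    intro n P₀ P h₀ hP he
    obtain ⟨h1, h2⟩ := hQ.coeff_mem_maximalIdeal_of_eval_add_sum_mem hJm hx hzI hz h₀ hP he
    exact Prod.ext (map_residue_eq_zero_of_coeff_mem h1)
      (funext fun j => map_residue_eq_zero_of_coeff_mem (h2 j))
  obtain huJ | ⟨huJ, hmu⟩ := hcase
  · rw [← pow_one J] at huJ
    obtain ⟨G₀, G, hG₀, hG, hGu⟩ := exists_sub_eval_add_sum_mem hzs huJ
    refine ⟨(map (residue R) G₀, fun j => map (residue R) (G j)), ?_, ?_⟩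
    · refine presentationMap_eq_zero hxI hzI hG₀ hG ?_
      have : maximalIdeal R * I * J ^ 1 ≤ maximalIdeal R * I ^ 2 := by
        rw [mul_assoc, pow_one, sq]
        exact Ideal.mul_mono_right (Ideal.mul_mono_right hJI)
      rw [← sub_sub_cancel u (eval x G₀ + _)]
      exact Ideal.sub_mem _ hu (this hGu)
    · refine mem_span_of_presentationMap_eq_zero hxI hzI _ ?_
      -- In degree one the value lies in 𝔪I itself, so independence alone suffices; u matters only
      -- from degree two on.
      rintro (_ | n) P₀ P h₀ hP he
      · rw [hinj 0 P₀ P h₀ hP (by simpa using he)]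
        exact Submodule.zero_mem _
      · obtain ⟨h, hh, hhe⟩ := mul_pow_le_of_mul_sq_le hI hle n he
        refine Submodule.mem_span_singleton.2 ⟨map (residue R) h, ?_⟩
        have := hinj (n + 1) (P₀ - h * G₀) (fun j => P j - h * G j) (h₀.sub (hh.mul hG₀))
          (fun j => (hP j).sub (hh.mul (hG j))) ?_
        · simp only [map_sub, map_mul] at this
          rw [eq_comm, ← sub_eq_zero, ← this]
          rfl
        · have h1 := Ideal.mul_mem_mul (eval_mem_span_range_pow (x := x) hh) hGu
          rw [mul_left_comm, ← pow_add] at h1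
          convert Ideal.add_mem _ hhe h1 using 1
          simp only [map_sub, map_mul, sub_mul, Finset.sum_sub_distrib, mul_assoc,
            ← Finset.mul_sum]
          ring
  · refine ⟨0, by simp [presentationMap], ?_⟩
    refine mem_span_of_presentationMap_eq_zero hxI hzI _ ?_
    rintro (_ | n) P₀ P h₀ hP he
    · rw [hinj 0 P₀ P h₀ hP (by simpa using he)]
      exact Submodule.zero_mem _
    · rw [hinj (n + 1) P₀ P h₀ hP ?_]
      · exact Submodule.zero_mem _
      · obtain ⟨h, hh, hhe⟩ := mul_pow_le_of_mul_sq_le hI hle n he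
        rw [← sub_add_cancel (eval x P₀ + _) (eval x h * u)]
        refine Ideal.add_mem _ hhe ?_
        by_cases hhu : ∃ m, coeff m h ∉ maximalIdeal R
        · refine absurd ?_ huJ
          rw [← pow_one J]
          refine hQ.mem_of_eval_mul_mem hJI hh hhu ?_
          rw [← sub_sub_cancel (eval x P₀ + ∑ j, eval x (P j) * z j) (eval x h * u)]
          refine Ideal.sub_mem _ (Ideal.add_mem _ ?_ (Ideal.sum_mem _ fun j _ => ?_)) ?_
          · refine Ideal.mul_mono_left hJI ?_
            rw [← pow_succ']
            exact eval_mem_span_range_pow h₀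
          · rw [mul_comm I]
            exact Ideal.mul_mem_mul (eval_mem_span_range_pow (hP j)) (hzI j)
          · exact Ideal.mul_mono_left Ideal.mul_le_right hhe
        · push Not at hhu
          have h1 : eval x h * u ∈ Ideal.span {u} * maximalIdeal R * J ^ n := by
            rw [mul_comm (eval x h), mul_assoc]
            exact Ideal.mul_mem_mul (Ideal.mem_span_singleton_self u)
              (eval_mem_mul_span_range_pow hh hhu)
          rw [pow_succ', ← mul_assoc, mul_assoc (maximalIdeal R)]
          refine Ideal.mul_mono_left ?_ h1
          rw [Ideal.span_singleton_mul_le_iff]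
          intro a ha
          rw [mul_comm u]
          exact hmu a ha

/-- Degrees zero and one lie in the image already, and I^(n+2) = I²J^n reduces all higher degrees to
degree two. -/
theorem exists_eq_presentationMap_add (hxI : ∀ i, x i ∈ I) (hzI : ∀ j, z j ∈ I)
    (hzs : I ≤ Ideal.span (Set.range z) ⊔ (Ideal.span (Set.range x) ⊔ maximalIdeal R * I))
    (hI : ∀ n, I ^ (n + 2) = I ^ 2 * Ideal.span (Set.range x) ^ n) {w₁ w₂ : R}
    (h₁ : w₁ ∈ I ^ 2) (h₂ : w₂ ∈ I ^ 2)
    (hw : I ^ 2 ≤ Ideal.span {w₁, w₂} ⊔ stepIdeal I (Ideal.span (Set.range x)) 2)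
    (c : FiberCone I) : ∃ q a b, c = presentationMap hxI hzI q +
      (fiberConeHom hxI a * Ideal.Quotient.mk (fiberConeIdeal I) (reesMonomial 2 w₁ h₁) +
        fiberConeHom hxI b * Ideal.Quotient.mk (fiberConeIdeal I) (reesMonomial 2 w₂ h₂)) := by
  obtain ⟨f, rfl⟩ := Ideal.Quotient.mk_surjective c
  set y₁ := Ideal.Quotient.mk (fiberConeIdeal I) (reesMonomial 2 w₁ h₁) with hy₁
  set y₂ := Ideal.Quotient.mk (fiberConeIdeal I) (reesMonomial 2 w₂ h₂) with hy₂
  let Q : FiberCone I → Prop := fun c => ∃ q a b, c = presentationMap hxI hzI q +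
    (fiberConeHom hxI a * y₁ + fiberConeHom hxI b * y₂)
  have hrange : ∀ c, (∃ q, c = presentationMap hxI hzI q) → Q c := by
    rintro _ ⟨q, rfl⟩
    exact ⟨q, 0, 0, by rw [map_zero, zero_mul, zero_mul, add_zero, add_zero]⟩
  have hadd : ∀ a b, Q a → Q b → Q (a + b) := by
    rintro _ _ ⟨q, a, b, rfl⟩ ⟨q', a', b', rfl⟩
    refine ⟨q + q', a + a', b + b', ?_⟩
    rw [presentationMap_add, map_add, map_add]
    ring
  have hmul : ∀ p a, Q a → Q (fiberConeHom hxI p * a) := by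
    rintro p _ ⟨q, a, b, rfl⟩
    refine ⟨p • q, p * a, p * b, ?_⟩
    rw [presentationMap_smul, map_mul, map_mul]
    ring
  have hgen : ∀ (w : R) (hw : w ∈ I ^ 2) (a : R),
      Ideal.Quotient.mk (fiberConeIdeal I) (reesMonomial 2 (a * w) (Ideal.mul_mem_left _ _ hw)) =
      fiberConeHom hxI (map (residue R) (C a)) *
        Ideal.Quotient.mk (fiberConeIdeal I) (reesMonomial 2 w hw) := by
    intro w hw a
    rw [fiberConeHom_map, ← map_mul, reesHom_mul_reesMonomial hxI (isHomogeneous_C _ a) hw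
      (by rw [mul_comm]; exact Ideal.mul_mem_left _ _ hw)]
    congr 1
    exact Subtype.ext (by simp [mul_comm])
  refine fiberCone_induction (Q := Q) (hrange 0 ⟨0, by simp [presentationMap]⟩) hadd fun n => ?_
  suffices ∀ t (ht : t ∈ I ^ n),
    Q (Ideal.Quotient.mk (fiberConeIdeal I) (reesMonomial n t ht)) from this _ _
  intro t hfn
  obtain _ | _ | n := n
  · exact hrange _ (mk_reesMonomial_mem_range hxI hzI hzs _ trivial)
  · refine hrange _ (mk_reesMonomial_mem_range hxI hzI hzs _ (Ideal.mem_sup_left ?_))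
    simpa using hfn
  · have ht : t ∈ I ^ (2 + n) := add_comm 2 n ▸ hfn
    rw [show reesMonomial (n + 1 + 1) t hfn = reesMonomial (2 + n) t ht from
      Subtype.ext (by rw [coe_reesMonomial, coe_reesMonomial, add_comm 2])]
    refine mk_reesMonomial_induction hxI (Q := Q) hadd hmul le_rfl ?_ (hI n ▸ hfn) ht
    intro c hc
    obtain ⟨b, hb, s, hs, hbs⟩ := Submodule.mem_sup.1 (hw hc)
    obtain ⟨a₁, a₂, rfl⟩ := Ideal.mem_span_pair.1 hb
    have hb' : a₁ * w₁ + a₂ * w₂ ∈ I ^ 2 :=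
      Ideal.add_mem _ (Ideal.mul_mem_left _ _ h₁) (Ideal.mul_mem_left _ _ h₂)
    have hs' : s ∈ I ^ 2 := by
      rw [← Ideal.add_mem_iff_right _ hb', hbs]
      exact hc
    subst hbs
    obtain ⟨q, hq⟩ := mk_reesMonomial_mem_range hxI hzI hzs hs' hs
    refine ⟨q, map (residue R) (C a₁), map (residue R) (C a₂), ?_⟩
    rw [reesMonomial_add hb' hs', reesMonomial_add (Ideal.mul_mem_left _ _ h₁)
      (Ideal.mul_mem_left _ _ h₂), map_add, map_add, hq, hgen, hgen, add_comm]

end FiberConePresentationCases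

/-! ### Quotients of length at most two -/

section QuotientLength

variable {R : Type u} [CommRing R] {A B : Ideal R}

theorem quotientLength_eq_zero_iff : quotientLength A B = 0 ↔ A ≤ B := by
  rw [quotientLength, Module.length_eq_zero_iff, Submodule.Quotient.subsingleton_iff,
    Submodule.submoduleOf, Submodule.comap_subtype_eq_top]

theorem quotientLength_span_singleton_sup_add_one_le {y : R} (hA : y ∈ A) (hB : y ∉ B) :
    quotientLength A (Ideal.span {y} ⊔ B) + 1 ≤ quotientLength A B := by
  have hle : B.submoduleOf A ≤ (Ideal.span {y} ⊔ B).submoduleOf A :=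
    Submodule.comap_mono le_sup_right
  let g := Submodule.factor hle
  rw [quotientLength, quotientLength, Module.length_eq_add_of_exact (LinearMap.ker g).subtype g
    (Submodule.subtype_injective _) (Submodule.factor_surjective hle)
    (LinearMap.exact_subtype_ker_map g), add_comm]
  refine add_le_add_left ?_ _
  rw [Order.one_le_iff_pos]
  refine @Module.length_pos _ _ _ _ _ ?_
  refine Submodule.nontrivial_iff_ne_bot.2 fun hbot => hB ?_
  have h1 : Submodule.Quotient.mk (p := B.submoduleOf A) ⟨y, hA⟩ ∈ LinearMap.ker g := by
    rw [LinearMap.mem_ker]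
    exact (Submodule.Quotient.mk_eq_zero _).2
      (Ideal.mem_sup_left (Ideal.mem_span_singleton_self y))
  rw [hbot, Submodule.mem_bot, Submodule.Quotient.mk_eq_zero] at h1
  exact h1

theorem quotientLength_span_singleton_sup_le {n : ℕ} (h : quotientLength A B ≤ (n + 1 : ℕ)) {y : R}
    (hA : y ∈ A) (hB : y ∉ B) : quotientLength A (Ideal.span {y} ⊔ B) ≤ n := by
  have := (quotientLength_span_singleton_sup_add_one_le hA hB).trans h
  rw [Nat.cast_succ] at this
  exact (ENat.add_le_add_iff_right ENat.one_ne_top).1 this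

theorem exists_le_span_singleton_sup {n : ℕ} (h : quotientLength A B ≤ (n + 1 : ℕ)) :
    ∃ y ∈ A, quotientLength A (Ideal.span {y} ⊔ B) ≤ n := by
  by_cases hAB : A ≤ B
  · refine ⟨0, A.zero_mem, ?_⟩
    rw [quotientLength_eq_zero_iff.2 (hAB.trans le_sup_right)]
    exact zero_le
  · obtain ⟨y, hA, hB⟩ := SetLike.not_le_iff_exists.1 hAB
    exact ⟨y, hA, quotientLength_span_singleton_sup_le h hA hB⟩

theorem le_of_quotientLength_le_zero (h : quotientLength A B ≤ (0 : ℕ)) : A ≤ B :=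
  quotientLength_eq_zero_iff.1 (nonpos_iff_eq_zero.1 (by simpa using h))

variable [IsLocalRing R]

/-- Nakayama for one element: w = t a w modulo B gives (1 - t a) w in B with 1 - t a a unit. -/
theorem notMem_span_singleton_mul_sup {a w : R} (ha : a ∈ maximalIdeal R) (haw : a * w ∉ B) :
    w ∉ Ideal.span {a * w} ⊔ B := by
  intro h
  obtain ⟨b, hb, c, hc, hbc⟩ := Submodule.mem_sup.1 h
  obtain ⟨t, rfl⟩ := Ideal.mem_span_singleton'.1 hb
  have hu : IsUnit (1 - t * a) := by
    by_contra hn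
    refine (Ideal.ne_top_iff_one _).1 (maximalIdeal.isMaximal R).ne_top ?_
    have := Ideal.add_mem _ ((mem_maximalIdeal _).2 hn) (Ideal.mul_mem_left _ t ha)
    rwa [sub_add_cancel] at this
  refine haw (Ideal.mul_mem_left _ _ ?_)
  rw [← Ideal.unit_mul_mem_iff_mem _ hu]
  convert hc using 1
  rw [eq_comm, ← sub_eq_zero, ← sub_eq_zero.2 hbc]
  ring

theorem maximalIdeal_mul_le_of_quotientLength_le_one (h : quotientLength A B ≤ (1 : ℕ)) :
    maximalIdeal R * A ≤ B := by
  rw [Ideal.mul_le]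
  intro a ha w hw
  by_contra hn
  have h1 := quotientLength_span_singleton_sup_le h (Ideal.mul_mem_left A a hw) hn
  exact notMem_span_singleton_mul_sup ha hn (le_of_quotientLength_le_zero h1 hw)

/-- The strict chain B < (aw) + B < (w) + B exhausts length two, so A/B is cyclic. A further product
c a w outside B, with c in 𝔪, would make the chain too long. -/
theorem le_span_singleton_sup_of_quotientLength_le_two (h : quotientLength A B ≤ (2 : ℕ)) {a w : R}
    (ha : a ∈ maximalIdeal R) (hw : w ∈ A) (haw : a * w ∉ B) :
    A ≤ Ideal.span {w} ⊔ B ∧ maximalIdeal R * (maximalIdeal R * A) ≤ B := by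
  have h1 := quotientLength_span_singleton_sup_le h (Ideal.mul_mem_left A a hw) haw
  have h2 := notMem_span_singleton_mul_sup ha haw
  have h3 := le_of_quotientLength_le_zero (quotientLength_span_singleton_sup_le h1 hw h2)
  have h4 : Ideal.span {a * w} ≤ Ideal.span {w} :=
    Ideal.span_singleton_le_span_singleton.2 (Dvd.intro_left a rfl)
  constructor
  · rwa [← sup_assoc, sup_eq_left.2 h4] at h3
  · refine (Ideal.mul_mono_right (maximalIdeal_mul_le_of_quotientLength_le_one h1)).trans ?_
    rw [Ideal.mul_sup, mul_comm, sup_le_iff, Ideal.span_singleton_mul_le_iff]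
    refine ⟨fun c hc => ?_, Ideal.mul_le_right⟩
    rw [mul_comm]
    by_contra hn
    have h5 := quotientLength_span_singleton_sup_le h
      (Ideal.mul_mem_left A c (Ideal.mul_mem_left A a hw)) hn
    have h6 := quotientLength_span_singleton_sup_le h5 (Ideal.mul_mem_left A a hw)
      (notMem_span_singleton_mul_sup hc hn)
    have h7 := le_of_quotientLength_le_zero h6 hw
    rw [← sup_assoc, sup_eq_left.2 (Ideal.span_singleton_le_span_singleton.2
      (Dvd.intro_left c rfl))] at h7
    exact h2 h7

end QuotientLength

/-! ### The depth bound for the fiber cone -/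

section FiberConeDepth

open MvPolynomial

theorem le_idealDepth_quotient_of_presentation {k A : Type u} [Field k] [CommRing A] {K : Ideal A}
    {n : ℕ} (φ : MvPolynomial (Fin (n + 1)) k →+* A ⧸ K) {𝔞 : Ideal (A ⧸ K)} (h𝔞 : 𝔞 ≠ ⊤)
    (hle : Ideal.span (Set.range X) ≤ 𝔞.comap φ) {r : ℕ} (y : Fin r → A ⧸ K)
    {Ψ : MvPolynomial (Fin (n + 1)) k × (Fin r → MvPolynomial (Fin (n + 1)) k) → A ⧸ K}
    (hΨ : ∀ p, Ψ p = φ p.1 + ∑ j, φ (p.2 j) * y j)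
    (hker : ∃ g, Ψ g = 0 ∧
      ∀ p, Ψ p = 0 → p ∈ Submodule.span (MvPolynomial (Fin (n + 1)) k) {g})
    (htf : ∀ p c, (∃ q, φ p * c = Ψ q) → p = 0 ∨ ∃ q, c = Ψ q) {w₁ w₂ : A ⧸ K}
    (hw : ∀ c, ∃ q a b, c = Ψ q + (φ a * w₁ + φ b * w₂)) : (n : ℕ∞) ≤ idealDepth 𝔞 (A ⧸ K) := by
  obtain ⟨g, hg, hker⟩ := hker
  exact le_idealDepth_of_presentation φ h𝔞 hle (hasDepthGE_span_range_X k (n + 1)) y hΨ g hg hker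
    htf hw

variable {R : Type u} [CommRing R] [IsLocalRing R] {I : Ideal R}

theorem QuasiRegular.le_fiberConeDepth [IsNoetherianRing R] {n : ℕ} {x : Fin (n + 1) → R}
    (hQ : QuasiRegular x) (hIm : I ≤ maximalIdeal R)
    (hx : ∀ a : Fin (n + 1) → R, ∑ i, a i * x i ∈ maximalIdeal R * I → ∀ i, a i ∈ maximalIdeal R)
    (hxI : ∀ i, x i ∈ I) (h3 : I ^ 3 = I ^ 2 * Ideal.span (Set.range x))
    (h₁ : quotientLength (I ^ 2) (I * Ideal.span (Set.range x)) ≤ (2 : ℕ))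
    (h₂ : quotientLength (maximalIdeal R * I ^ 2)
      (maximalIdeal R * (I * Ideal.span (Set.range x))) ≤ (1 : ℕ)) :
    (n : ℕ∞) ≤ fiberConeDepth I := by
  have hI : ∀ k, I ^ (k + 2) = I ^ 2 * Ideal.span (Set.range x) ^ k := by
    intro k
    induction k with
    | zero => simp
    | succ k ih =>
      rw [add_right_comm, pow_succ, ih, mul_right_comm, ← pow_succ, h3, mul_assoc, ← pow_succ']
  have hJI : Ideal.span (Set.range x) ≤ I := Ideal.span_le.2 (by rintro _ ⟨i, rfl⟩; exact hxI i)
  obtain ⟨r, z, hzI, hzs, hz⟩ :=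
    exists_independent_generators I (Ideal.span (Set.range x) ⊔ maximalIdeal R * I)
  obtain ⟨w₁, hw₁, h₁'⟩ := exists_le_span_singleton_sup h₁
  obtain ⟨w₂, hw₂, h₁''⟩ := exists_le_span_singleton_sup h₁'
  have hw : I ^ 2 ≤ Ideal.span {w₁, w₂} ⊔ stepIdeal I (Ideal.span (Set.range x)) 2 := by
    refine (le_of_quotientLength_le_zero h₁'').trans ?_
    rw [← sup_assoc, ← Ideal.span_union, Set.singleton_union, Set.pair_comm]
    refine sup_le_sup_left ?_ _
    exact le_sup_of_le_left (by rw [pow_one])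
  obtain ⟨u, hu, h₂'⟩ := exists_le_span_singleton_sup h₂
  have hle := le_of_quotientLength_le_zero h₂'
  have hmu : ∀ a ∈ maximalIdeal R,
      a * u ∈ maximalIdeal R * (I * Ideal.span (Set.range x)) := fun a ha =>
    maximalIdeal_mul_le_of_quotientLength_le_one h₂ (Ideal.mul_mem_mul ha hu)
  unfold fiberConeDepth
  refine le_idealDepth_quotient_of_presentation (fiberConeHom hxI) (fiberConeMaximalIdeal_ne_top I)
    (span_range_X_le_comap_fiberConeHom hxI)
    (fun j => Ideal.Quotient.mk (fiberConeIdeal I)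
      (reesMonomial 1 (z j) (by rw [pow_one]; exact hzI j)))
    (Ψ := presentationMap hxI hzI) (fun p => rfl)
    (hQ.exists_ker_presentationMap (hJI.trans hIm) hx hz hxI hzI hzs hI hu hle
      ((em _).imp_right fun h => ⟨h, hmu⟩))
    (eq_zero_or_exists_eq_presentationMap hxI hzI hzs fun k l f s hf hfu hs hfs => ?_)
    (exists_eq_presentationMap_add hxI hzI hzs hI hw₁ hw₂ hw)
  -- Either 𝔪 kills I²/IJ, or some a w outside IJ shows that I²/IJ is cyclic and killed by 𝔪²;
  -- torsion-freeness has a separate argument for each.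
  by_cases hmI : maximalIdeal R * I ^ 2 ≤ I * Ideal.span (Set.range x)
  · exact hQ.mem_stepIdeal_of_maximalIdeal_mul_sq_le hxI hI hmI hf hfu hs hfs
  · rw [Ideal.mul_le] at hmI
    push Not at hmI
    obtain ⟨a, ha, w, hwI, haw⟩ := hmI
    obtain ⟨h4, h5⟩ := le_span_singleton_sup_of_quotientLength_le_two h₁ ha hwI haw
    refine hQ.mem_stepIdeal_of_notMem hxI hI h5 hwI (h4.trans (sup_le_sup_left ?_ _)) ha haw hf hfu
      hs hfs
    exact le_sup_of_le_left (by rw [pow_one])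

theorem IsMinimalReduction.le_fiberConeDepth_add_one (hR : IsCohenMacaulayLocalRing R)
    [Infinite (ResidueField R)] {d : ℕ} (hd : 0 < d) (hdim : ringKrullDim R = (d : WithBot ℕ∞))
    {J : Ideal R} (hI : I.radical = maximalIdeal R) (hJ : IsMinimalReduction J I)
    (h3 : I ^ 3 = I ^ 2 * J) (h₁ : quotientLength (I ^ 2) (I * J) ≤ (2 : ℕ))
    (h₂ : quotientLength (maximalIdeal R * I ^ 2) (maximalIdeal R * (I * J)) ≤ (1 : ℕ)) :
    (d : ℕ∞) ≤ fiberConeDepth I + 1 := by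
  have := hR.isNoetherianRing
  obtain ⟨n, rfl⟩ := Nat.exists_eq_add_one_of_ne_zero hd.ne'
  obtain ⟨x, rfl, hQ, hx⟩ := hJ.exists_quasiRegular hR hdim hI
  have hxI : ∀ i, x i ∈ I := fun i => hJ.1.1 (Ideal.subset_span (Set.mem_range_self i))
  rw [Nat.cast_succ]
  exact add_le_add_left (hQ.le_fiberConeDepth (Ideal.le_radical.trans hI.le) hx hxI h3 h₁ h₂) 1

end FiberConeDepth

theorem corollary4p4 {R : Type u} [CommRing R] [IsLocalRing R]
    (hR : IsCohenMacaulayLocalRing R) [Infinite (ResidueField R)]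
    (d : ℕ) (hd : 0 < d) (hdim : ringKrullDim R = (d : WithBot ℕ∞))
    (I J : Ideal R) (hI : IsMaximalIdealPrimary I) (hJ : IsMinimalReduction J I)
    (h3 : I ^ 3 = I ^ 2 * J) :
    (quotientLength (I ^ 2) (I * J) = 1 →
      quotientLength (maximalIdeal R * I ^ 2) (maximalIdeal R * (J * I)) = 1 →
      (d : ℕ∞) ≤ fiberConeDepth I + 1) ∧
    (quotientLength (I ^ 2) (I * J) = 2 →
      quotientLength (maximalIdeal R * I ^ 2) (maximalIdeal R * (I * J)) = 1 →
      (d : ℕ∞) ≤ fiberConeDepth I + 2) ∧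
    (quotientLength (I ^ 2) (I * J) = 2 →
      quotientLength (maximalIdeal R * I) (maximalIdeal R * J) = 2 →
      maximalIdeal R * I ^ 2 = maximalIdeal R * (I * J) →
      (d : ℕ∞) ≤ fiberConeDepth I + 2) := by
  have key := fun h₁ h₂ => hJ.le_fiberConeDepth_add_one hR hd hdim hI.2 h3 h₁ h₂
  have h12 : fiberConeDepth I + 1 ≤ fiberConeDepth I + 2 := by
    gcongr
    exact one_le_two
  -- Each case meets the bounds λ(I²/IJ) ≤ 2 and λ(𝔪I²/𝔪IJ) ≤ 1, the second length being zero in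
  -- case (iii). For (ii) and (iii) the resulting d - 1 is weakened to d - 2.
  refine ⟨fun h₁ h₂ => ?_, fun h₁ h₂ => ?_, fun h₁ _ h₂ => ?_⟩
  · refine key ?_ ?_
    · rw [h₁]
      exact one_le_two
    · rw [mul_comm I J, h₂, Nat.cast_one]
  · exact (key (by rw [h₁]; rfl) (by rw [h₂, Nat.cast_one])).trans h12
  · refine (key (by rw [h₁]; rfl) ?_).trans h12
    rw [h₂, quotientLength_eq_zero_iff.2 le_rfl]
    exact zero_le
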